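/- **Setting.** A random forest consists of $n\ge 1$ decision trees $T_0,\dots,T_{n-1}$ over objects $X=(x_1,\dots,x_d)$, $d \ge 1$. Each inner node tests one attribute, the test has $g$ possible outcomes and the edge labelled by the outcome is followed; leaves carry real labels. Let $h$ be the maximum height of the trees, let $y_{\min}<y_{\max}$ be the smallest and the largest leaf label among all trees, let $y_i$ be the label of the leaf that $T_i$ reaches on $X$, and put $$R=\frac1n\sum_{i=0}^{n-1}y_i,\qquad \beta=\frac1n\sum_{i=0}^{n-1}\frac{y_i-y_{\min}}{y_{\max}-y_{\min}},\qquad \alpha_i=\arcsin\sqrt{\frac{y_i-y_{\min}}{y_{\max}-y_{\min}}}.$$ A query is one application of the oracle $|j\rangle|z\rangle|w\rangle\mapsto|j\rangle|z+x_j\rangle|w\rangle$ or of its inverse, where the attribute values lie in an abelian group (for example $\mathbb R$, or $\mathbb Z/2$ for binary attributes); all other gates are unitary and do not depend on $X$. **Algorithm.** The circuit $\mathcal U$ puts the tree index into uniform superposition (by any fixed unitary with $|0\rangle\mapsto\frac1{\sqrt n}\sum_i|i\rangle$, such as Hadamard gates if $n$ is a power of two), walks each tree coherently from its root to a leaf by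 at most $h$ attribute tests, and rotates the output qubit by $R_y(2\alpha)$, where $\alpha=\arcsin\sqrt{(y-y_{\min})/(y_{\max}-y_{\min})}$ for the label $y$ of the leaf reached. With $|\Psi\rangle=\mathcal U|0\rangle$, $D=2|\Psi\rangle\langle\Psi|-I=\mathcal U(2|0\rangle\langle0|-I)\mathcal U^{-1}$, $P$ the projector onto output qubit $1$ and $V=I-2P$, amplitude estimation with integer parameter $T\ge1$ applies $(DV)^k$ to $|\Psi\rangle$ controlled by a counter in uniform superposition over $0\le k<T$, applies the inverse quantum Fourier transform of order $T$ to the counter, measures $k'$ there and returns $\sin^2(\pi k'/T)$. The algorithm runs this $m(\delta)$ times independently; $\tilde\beta$ is the median of the returned values, and $\tilde R=y_{\min}+(y_{\max}-y_{\min})\tilde\beta$. **Theorem.** There are a number of repetitions $m(\delta)$, depending only on $\delta$, and an absolute constant $C$ such that the following holds for all forests as above, all objects $X$, all integers $t\ge1$ and all $0<\delta<1$. 1. $\mathcal U|0\rangle=\frac1{\sqrt n}\sum_{i=0}^{n-1}|i\rangle|j_i\rangle\bigl(\cos\alpha_i|0\rangle+\sin\alpha_i|1\rangle\bigr)$ with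 all other registers zero, where $j_i$ addresses the leaf that $T_i$ reaches on $X$. 2. (Forecasting $\beta$.) With $T=t$, with probability at least $1-\delta$, $$|\tilde\beta-\beta|\le\frac{2\pi\sqrt{\beta(1-\beta)}}{t}+\frac{\pi^2}{t^2},$$ and the algorithm makes at most $C\,t\,h\,\max\{1,\log\frac1\delta\}$ queries. 3. (Forecasting $R$.) With $T=\lceil t(y_{\max}-y_{\min})\rceil$, with probability at least $1-\delta$, $$|\tilde R-R|\le\frac{2\pi\sqrt{\beta(1-\beta)}}{t}+\frac{\pi^2}{t^2(y_{\max}-y_{\min})}\quad\text{and}\quad|\tilde R-R|\le\frac{2\pi+\pi^2}{t},$$ and the algorithm makes at most $C\,\max\{1,t(y_{\max}-y_{\min})\}\,h\,\max\{1,\log\frac1\delta\}$ queries. That is, the query complexity is $O(t\cdot h\cdot\log\frac1\delta)$ for $\beta$ and $O(t(y_{\max}-y_{\min})\cdot h\cdot\log\frac1\delta)$ for $R$. -/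

import Mathlib

open Matrix MeasureTheory

/-! ## Decision trees and forests -/

/-- A decision tree over objects with `d` attributes, each attribute with values in `A`. An inner
node tests one attribute `j`; the test has the `g` possible outcomes `0, …, g - 1`, and the edge
labelled by the outcome is followed. A leaf is labelled by a real number.
(`A = ℝ` serves real-valued attributes and attributes with values in `{1, …, W} ⊆ ℝ`.) -/
inductive DTree (d g : ℕ) (A : Type) : Type
  | leaf (y : ℝ) : DTree d g A
  | node (j : Fin d) (test : A → Fin g) (child : Fin g → DTree d g A) : DTree d g A

namespace DTree

variable {d g : ℕ} {A : Type}

/-- The (classical) result of the tree for the object `X`. -/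
def eval (X : Fin d → A) : DTree d g A → ℝ
  | leaf y => y
  | node j test child => (child (test (X j))).eval X

/-- The largest number of tests on a way from the root to a leaf. -/
def height : DTree d g A → ℕ
  | leaf _ => 0
  | node _ _ child => 1 + Finset.univ.sup fun b => (child b).height

/-- The smallest label of a leaf. -/
noncomputable def minLabel [NeZero g] : DTree d g A → ℝ
  | leaf y => y
  | node _ _ child => Finset.univ.inf' Finset.univ_nonempty fun b => (child b).minLabel

/-- The largest label of a leaf. -/
noncomputable def maxLabel [NeZero g] : DTree d g A → ℝ
  | leaf y => y
  | node _ _ child => Finset.univ.sup' Finset.univ_nonempty fun b => (child b).maxLabel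

/-- The node (with the subtree below it) that is reached from the root along the edges labelled by
the given outcomes; one stays in a leaf once it is reached. -/
def descend : DTree d g A → List (Fin g) → DTree d g A
  | T, [] => T
  | leaf y, _ :: _ => leaf y
  | node _ _ child, b :: bs => (child b).descend bs

/-- The attribute tested in the root (attribute `0`, as a dummy, if the root is a leaf). -/
def attr [NeZero d] : DTree d g A → Fin d
  | leaf _ => 0
  | node j _ _ => j

/-- The outcome of the test in the root if the tested attribute has value `z`
(`0`, as a dummy, if the root is a leaf). -/
def outcome [NeZero g] (z : A) : DTree d g A → Fin g
  | leaf _ => 0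
  | node _ test _ => test z

/-- The label of the root if it is a leaf (and `0`, as a dummy, otherwise). -/
def label : DTree d g A → ℝ
  | leaf y => y
  | node _ _ _ => 0

end DTree

/-- The maximum height of the trees of a forest. -/
def forestHeight {d g n : ℕ} {A : Type} (F : Fin n → DTree d g A) : ℕ :=
  Finset.univ.sup fun i => (F i).height

/-- The smallest leaf label among all the trees. -/
noncomputable def yMin {d g n : ℕ} {A : Type} [NeZero g] [NeZero n]
    (F : Fin n → DTree d g A) : ℝ :=
  Finset.univ.inf' Finset.univ_nonempty fun i => (F i).minLabel

/-- The largest leaf label among all the trees. -/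
noncomputable def yMax {d g n : ℕ} {A : Type} [NeZero g] [NeZero n]
    (F : Fin n → DTree d g A) : ℝ :=
  Finset.univ.sup' Finset.univ_nonempty fun i => (F i).maxLabel

/-- The forecast `R` of the random forest: the average of the results of the trees. -/
noncomputable def forecast {d g n : ℕ} {A : Type} (F : Fin n → DTree d g A) (X : Fin d → A) : ℝ :=
  (1 / (n : ℝ)) * ∑ i, (F i).eval X

/-- The normalized forecast `β`. -/
noncomputable def normalizedForecast {d g n : ℕ} {A : Type} [NeZero g] [NeZero n]
    (F : Fin n → DTree d g A) (X : Fin d → A) : ℝ :=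
  (1 / (n : ℝ)) * ∑ i, ((F i).eval X - yMin F) / (yMax F - yMin F)

/-! ## The quantum query model -/

/-- Labels `|j⟩|z⟩|w⟩` of the computational basis: index of a variable, value register, workspace. -/
abbrev QBasis (d : ℕ) (A W : Type) : Type := Fin d × A × W

/-- One instruction of a quantum query algorithm with `d` input variables in the group `A`.
Only `query` and `queryInv` have access to the input. -/
inductive Instr (d : ℕ) (A W : Type) : Type 1
  /-- a classical reversible gate, `|b⟩ ↦ |σ b⟩` -/
  | perm (σ : Equiv.Perm (QBasis d A W)) : Instr d A W
  /-- a conditional phase flip, `|b⟩ ↦ s b |b⟩` with signs `s b = ± 1` -/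
  | flip (s : QBasis d A W → ℤˣ) : Instr d A W
  /-- a uniformly controlled gate: the unitary `M k` is applied to a register with the finite
  set `T` of basis labels if the remaining registers are in the basis state `k` -/
  | ucg {K T : Type} [Fintype T] [DecidableEq T] (e : QBasis d A W ≃ K × T)
      (M : K → Matrix.unitaryGroup T ℂ) : Instr d A W
  /-- the oracle, `|j⟩|z⟩|w⟩ ↦ |j⟩|z + x_j⟩|w⟩` -/
  | query : Instr d A W
  /-- the inverse of the oracle, `|j⟩|z⟩|w⟩ ↦ |j⟩|z - x_j⟩|w⟩` -/
  | queryInv : Instr d A W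

/-- A circuit; the head of the list is applied first. -/
abbrev Circuit (d : ℕ) (A W : Type) : Type 1 := List (Instr d A W)

namespace Instr

variable {d : ℕ} {A W : Type}

/-- The number of queries made by an instruction. -/
def queries : Instr d A W → ℕ
  | query => 1
  | queryInv => 1
  | _ => 0

/-- The inverse instruction. -/
noncomputable def inv : Instr d A W → Instr d A W
  | perm σ => perm σ.symm
  | flip s => flip s⁻¹
  | ucg e M => ucg e M⁻¹
  | query => queryInv
  | queryInv => query

/-- The action of an instruction on a state (given by its amplitudes) for the input `X`. -/
noncomputable def apply [AddCommGroup A] (X : Fin d → A) :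
    Instr d A W → (QBasis d A W → ℂ) → (QBasis d A W → ℂ)
  | perm σ, ψ => fun b => ψ (σ.symm b)
  | flip s, ψ => fun b => ((s b : ℤ) : ℂ) * ψ b
  | ucg e M, ψ => fun b => ∑ a, (M (e b).1 : Matrix _ _ ℂ) (e b).2 a * ψ (e.symm ((e b).1, a))
  | query, ψ => fun b => ψ (b.1, b.2.1 - X b.1, b.2.2)
  | queryInv, ψ => fun b => ψ (b.1, b.2.1 + X b.1, b.2.2)

end Instr

/-- The total squared norm of a state. -/
noncomputable def stateWeight {ι : Type} (ψ : ι → ℂ) : ENNReal := ∑' b, ‖ψ b‖ₑ ^ 2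

theorem unitary_weight {T : Type} [Fintype T] [DecidableEq T] (M : Matrix.unitaryGroup T ℂ)
    (v : T → ℂ) : ∑ a, ‖∑ c, (M : Matrix T T ℂ) a c * v c‖ₑ ^ 2 = ∑ a, ‖v a‖ₑ ^ 2 := by
  have key : ∀ w : T → ℂ, ((∑ a, ‖w a‖ ^ 2 : ℝ) : ℂ) = star w ⬝ᵥ w := by
    intro w
    rw [dotProduct, Complex.ofReal_sum]
    refine Finset.sum_congr rfl fun a _ => ?_
    rw [Pi.star_apply, Complex.star_def, Complex.conj_mul']
    push_cast; rfl
  have h2 : star ((M : Matrix T T ℂ) *ᵥ v) ⬝ᵥ ((M : Matrix T T ℂ) *ᵥ v) = star v ⬝ᵥ v := by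
    rw [Matrix.star_mulVec, Matrix.dotProduct_mulVec, Matrix.vecMul_vecMul]
    have : (M : Matrix T T ℂ)ᴴ * (M : Matrix T T ℂ) = 1 :=
      (Matrix.mem_unitaryGroup_iff').1 M.2
    rw [this, Matrix.vecMul_one]
  have h3 : (∑ a, ‖((M : Matrix T T ℂ) *ᵥ v) a‖ ^ 2 : ℝ) = ∑ a, ‖v a‖ ^ 2 := by
    rw [← key, ← key] at h2
    exact_mod_cast h2
  have h4 : ∀ w : T → ℂ, ∑ a, ‖w a‖ₑ ^ 2 = ENNReal.ofReal (∑ a, ‖w a‖ ^ 2) := by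
    intro w
    rw [ENNReal.ofReal_sum_of_nonneg fun a _ => by positivity]
    refine Finset.sum_congr rfl fun a _ => ?_
    rw [ENNReal.ofReal_pow (norm_nonneg _), ofReal_norm]
  have h5 := h4 ((M : Matrix T T ℂ) *ᵥ v)
  rw [h3, ← h4] at h5
  exact h5

theorem Instr.apply_weight {d : ℕ} {A W : Type} [AddCommGroup A] (X : Fin d → A)
    (I : Instr d A W) (ψ : QBasis d A W → ℂ) : stateWeight (I.apply X ψ) = stateWeight ψ := by
  cases I with
  | perm σ => exact σ.symm.tsum_eq fun b => ‖ψ b‖ₑ ^ 2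
  | flip s =>
    refine tsum_congr fun b => ?_
    rcases Int.units_eq_one_or (s b) with h | h <;> simp [Instr.apply, h]
  | @ucg K T _ _ e M =>
    unfold stateWeight
    rw [← e.symm.tsum_eq, ← e.symm.tsum_eq fun b => ‖ψ b‖ₑ ^ 2, ENNReal.tsum_prod',
      ENNReal.tsum_prod']
    refine tsum_congr fun k => ?_
    rw [tsum_fintype, tsum_fintype]
    simpa [Instr.apply] using unitary_weight (M k) fun a => ψ (e.symm (k, a))
  | query =>
    let σ : Equiv.Perm (QBasis d A W) :=
      { toFun := fun b => (b.1, b.2.1 - X b.1, b.2.2)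
        invFun := fun b => (b.1, b.2.1 + X b.1, b.2.2)
        left_inv := fun b => by simp
        right_inv := fun b => by simp }
    exact σ.tsum_eq fun b => ‖ψ b‖ₑ ^ 2
  | queryInv =>
    let σ : Equiv.Perm (QBasis d A W) :=
      { toFun := fun b => (b.1, b.2.1 + X b.1, b.2.2)
        invFun := fun b => (b.1, b.2.1 - X b.1, b.2.2)
        left_inv := fun b => by simp
        right_inv := fun b => by simp }
    exact σ.tsum_eq fun b => ‖ψ b‖ₑ ^ 2

namespace Circuit

variable {d : ℕ} {A W : Type}

/-- The number of queries of a circuit. -/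
def queries (c : Circuit d A W) : ℕ := (c.map Instr.queries).sum

/-- The inverse circuit. -/
noncomputable def inv (c : Circuit d A W) : Circuit d A W := (c.map Instr.inv).reverse

/-- The state after the circuit is applied to the state `ψ`, for the input `X`. -/
noncomputable def run [AddCommGroup A] (X : Fin d → A) (c : Circuit d A W)
    (ψ : QBasis d A W → ℂ) : QBasis d A W → ℂ :=
  c.foldl (fun φ I => I.apply X φ) ψ

theorem run_weight [AddCommGroup A] (X : Fin d → A) (c : Circuit d A W)
    (ψ : QBasis d A W → ℂ) : stateWeight (c.run X ψ) = stateWeight ψ := by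
  induction c generalizing ψ with
  | nil => rfl
  | cons I c ih => exact (ih (I.apply X ψ)).trans (I.apply_weight X ψ)

end Circuit

open Classical in
/-- The basis state `|b⟩`. -/
noncomputable def ket {ι : Type} (b : ι) : ι → ℂ := Pi.single b 1

theorem ket_weight {ι : Type} (b : ι) : stateWeight (ket b) = 1 := by
  classical
  unfold stateWeight ket
  rw [tsum_eq_single b]
  · simp
  · intro c hc
    simp [Pi.single_eq_of_ne hc]

/-- The law of the outcome when all registers are measured in the computational basis after the
circuit is applied to `|b₀⟩`: the outcome `b` has probability `|amplitude of b|²`. -/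
noncomputable def Circuit.measure {d : ℕ} {A W : Type} [AddCommGroup A] (X : Fin d → A)
    (c : Circuit d A W) (b₀ : QBasis d A W) : PMF (QBasis d A W) :=
  ⟨fun b => ‖c.run X (ket b₀) b‖ₑ ^ 2,
    ENNReal.summable.hasSum_iff.2 ((c.run_weight X (ket b₀)).trans (ket_weight b₀))⟩

/-! ## Gates -/

/-- The matrix of the discrete Fourier transform on `ℤ / t`. -/
noncomputable def dftMatrix (t : ℕ) : Matrix (Fin t) (Fin t) ℂ := Matrix.of fun y k =>
  (1 / (Real.sqrt t : ℂ)) * Complex.exp (2 * Real.pi * Complex.I * (y : ℕ) * (k : ℕ) / (t : ℂ))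

theorem dftMatrix_mem (t : ℕ) : dftMatrix t ∈ Matrix.unitaryGroup (Fin t) ℂ := by
  rcases Nat.eq_zero_or_pos t with rfl | ht
  · exact (Matrix.mem_unitaryGroup_iff).2 (by ext i; exact i.elim0)
  have ht' : (t : ℂ) ≠ 0 := by exact_mod_cast ht.ne'
  have hs : ((Real.sqrt t : ℝ) : ℂ) * (Real.sqrt t : ℝ) = t := by
    rw [← Complex.ofReal_mul, Real.mul_self_sqrt (by positivity)]; simp
  have hs0 : ((Real.sqrt t : ℝ) : ℂ) ≠ 0 := by
    intro h; rw [h] at hs; simp at hs; exact ht' hs.symm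
  have hprim := Complex.isPrimitiveRoot_exp t ht.ne'
  rw [Matrix.mem_unitaryGroup_iff]
  ext a b
  rw [Matrix.mul_apply, Matrix.one_apply]
  have hterm : ∀ k : Fin t, dftMatrix t a k * (star (dftMatrix t)) k b =
      (1 / (t : ℂ)) *
        Complex.exp (2 * Real.pi * Complex.I * (((a : ℕ) : ℂ) - ((b : ℕ) : ℂ)) / t) ^ (k : ℕ) := by
    intro k
    have hc : (starRingEnd ℂ) (2 * Real.pi * Complex.I * (b : ℕ) * (k : ℕ) / (t : ℂ)) =
        -(2 * Real.pi * Complex.I * (b : ℕ) * (k : ℕ) / (t : ℂ)) := by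
      simp only [map_div₀, map_mul, map_ofNat, Complex.conj_ofReal, Complex.conj_I,
        map_natCast]
      ring
    simp only [dftMatrix, Matrix.star_apply, Matrix.of_apply, star_mul', Complex.star_def,
      ← Complex.exp_conj, hc]
    rw [map_div₀, map_one, Complex.conj_ofReal, ← Complex.exp_nat_mul]
    rw [mul_mul_mul_comm, ← Complex.exp_add]
    congr 1
    · rw [div_mul_div_comm, hs, one_mul]
    · congr 1; ring
  rw [Finset.sum_congr rfl fun k _ => hterm k, ← Finset.mul_sum,
    Fin.sum_univ_eq_sum_range fun k =>
      Complex.exp (2 * Real.pi * Complex.I * (((a : ℕ) : ℂ) - ((b : ℕ) : ℂ)) / t) ^ k]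
  set w := Complex.exp (2 * Real.pi * Complex.I * (((a : ℕ) : ℂ) - ((b : ℕ) : ℂ)) / t) with hw
  have hwt : w ^ t = 1 := by
    rw [hw, ← Complex.exp_nat_mul, Complex.exp_eq_one_iff]
    refine ⟨(a : ℤ) - (b : ℤ), ?_⟩
    push_cast; field_simp
  split_ifs with hab
  · subst hab
    have : w = 1 := by rw [hw]; simp
    simp [this, ht']
  · have hw1 : w ≠ 1 := by
      intro h1
      apply hab
      have h2 : Complex.exp (2 * Real.pi * Complex.I / t) ^ (a : ℕ) =
          Complex.exp (2 * Real.pi * Complex.I / t) ^ (b : ℕ) := by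
        rw [← Complex.exp_nat_mul, ← Complex.exp_nat_mul]
        have h3 : ((a : ℕ) : ℂ) * (2 * Real.pi * Complex.I / t) =
            2 * Real.pi * Complex.I * (((a : ℕ) : ℂ) - ((b : ℕ) : ℂ)) / t +
              ((b : ℕ) : ℂ) * (2 * Real.pi * Complex.I / t) := by ring
        rw [h3, Complex.exp_add, ← hw, h1, one_mul]
      exact Fin.ext (hprim.pow_inj a.2 b.2 h2)
    have h4 := mul_neg_geom_sum w t
    rw [hwt, sub_self, mul_eq_zero] at h4
    rcases h4 with h4 | h4
    · exact absurd (sub_eq_zero.1 h4).symm hw1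
    · rw [h4, mul_zero]

/-- The quantum Fourier transform. -/
noncomputable def dft (t : ℕ) : Matrix.unitaryGroup (Fin t) ℂ := ⟨dftMatrix t, dftMatrix_mem t⟩

/-- The rotation `R_y(2α)`. -/
noncomputable def rotMatrix (α : ℝ) : Matrix (Fin 2) (Fin 2) ℂ :=
  !![(Real.cos α : ℂ), -(Real.sin α : ℂ); (Real.sin α : ℂ), (Real.cos α : ℂ)]

theorem rotMatrix_mem (α : ℝ) : rotMatrix α ∈ Matrix.unitaryGroup (Fin 2) ℂ := by
  have h : (Real.cos α : ℂ) * Real.cos α + (Real.sin α : ℂ) * Real.sin α = 1 := by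
    rw [← Complex.ofReal_mul, ← Complex.ofReal_mul, ← Complex.ofReal_add, ← sq, ← sq,
      Real.cos_sq_add_sin_sq, Complex.ofReal_one]
  rw [Matrix.mem_unitaryGroup_iff]
  ext i j
  fin_cases i <;> fin_cases j <;>
    simp only [rotMatrix, Matrix.mul_apply, Fin.sum_univ_two, Matrix.star_apply, Fin.zero_eta,
      Fin.mk_one, Fin.isValue, Matrix.of_apply, Matrix.cons_val', Matrix.cons_val_zero,
      Matrix.cons_val_one, Matrix.cons_val_fin_one, Complex.star_def, map_neg,
      Complex.conj_ofReal, Matrix.one_apply_eq, ne_eq, zero_ne_one, one_ne_zero,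
      not_false_eq_true, Matrix.one_apply_ne]
  · linear_combination h
  · ring
  · ring
  · linear_combination h

/-- The rotation `R_y(2α)` as a unitary matrix; it maps `|0⟩` to `cos α |0⟩ + sin α |1⟩`. -/
noncomputable def rot (α : ℝ) : Matrix.unitaryGroup (Fin 2) ℂ := ⟨rotMatrix α, rotMatrix_mem α⟩

/-! ## The algorithm -/

/-- The workspace: the counting register of the amplitude estimation, the index of a tree, the
index of a node, and the output qubit. A node of a tree of height at most `h` is addressed by the
outcomes of the tests on the way to it from the root (for `g = 2` these are the binary digits below
the leading one of its number in the level-by-level enumeration); digits not yet written are `0`. -/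
structure ForestWork (t n h g : ℕ) : Type where
  count : Fin t
  tree : Fin n
  path : Fin h → Fin g
  out : Fin 2

section Algorithm

variable {d g n : ℕ} {A : Type}

/-- The basis labels of the algorithm for the forest `F`. -/
abbrev ForestBasis (F : Fin n → DTree d g A) (t : ℕ) : Type :=
  QBasis d A (ForestWork t n (forestHeight F) g)

/-- Circuits on the registers of the algorithm for the forest `F`. -/
abbrev ForestCircuit (F : Fin n → DTree d g A) (t : ℕ) : Type 1 :=
  Circuit d A (ForestWork t n (forestHeight F) g)

/-- The initial label: all registers are zero. -/
def zeroLabel [NeZero d] [NeZero g] [NeZero n] [AddCommGroup A] (F : Fin n → DTree d g A)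
    (t : ℕ) [NeZero t] : ForestBasis F t :=
  (0, 0, ⟨0, 0, fun _ => 0, 0⟩)

/-- The node of the tree `T` addressed by the first `s` digits of `p`. -/
def nodeAt {h : ℕ} (T : DTree d g A) (p : Fin h → Fin g) (s : ℕ) : DTree d g A :=
  T.descend ((List.ofFn p).take s)

theorem nodeAt_update {h : ℕ} (T : DTree d g A) (p : Fin h → Fin g) (s : Fin h) (b : Fin g) :
    nodeAt T (Function.update p s b) s = nodeAt T p s := by
  unfold nodeAt
  congr 1
  refine List.ext_getElem (by simp) fun k h1 h2 => ?_
  have hk : k < (s : ℕ) := by simp at h1; omega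
  have hne : (⟨k, hk.trans s.2⟩ : Fin h) ≠ s := fun h => by simp [← h] at hk
  simp [List.getElem_take, Function.update_of_ne hne]

/-- The attribute tested in the node addressed by the first `s` digits of the node register is
added to the index register. -/
def setIndex [NeZero d] (F : Fin n → DTree d g A) (t s : ℕ) :
    Equiv.Perm (ForestBasis F t) where
  toFun b := (b.1 + (nodeAt (F b.2.2.tree) b.2.2.path s).attr, b.2.1, b.2.2)
  invFun b := (b.1 - (nodeAt (F b.2.2.tree) b.2.2.path s).attr, b.2.1, b.2.2)
  left_inv b := by simp
  right_inv b := by simp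

/-- One step down in the tree: the outcome of the test in the node addressed by the first `s`
digits, for the attribute value in the value register, is added to the digit number `s`. -/
def moveDown [NeZero g] (F : Fin n → DTree d g A) (t : ℕ) (s : Fin (forestHeight F)) :
    Equiv.Perm (ForestBasis F t) where
  toFun b := (b.1, b.2.1, { b.2.2 with
    path := Function.update b.2.2.path s
      (b.2.2.path s + (nodeAt (F b.2.2.tree) b.2.2.path s).outcome b.2.1) })
  invFun b := (b.1, b.2.1, { b.2.2 with
    path := Function.update b.2.2.path s
      (b.2.2.path s - (nodeAt (F b.2.2.tree) b.2.2.path s).outcome b.2.1) })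
  left_inv b := by simp [nodeAt_update]
  right_inv b := by simp [nodeAt_update]

/-- Level `s` of the walk from the root to a leaf: look up the attribute that is tested in the
current node, move to the child given by the outcome of the test, and undo the look-up. -/
noncomputable def walkStep [NeZero d] [NeZero g] (F : Fin n → DTree d g A) (t : ℕ)
    (s : Fin (forestHeight F)) : ForestCircuit F t :=
  [.perm (setIndex F t s), .query, .perm (moveDown F t s), .queryInv, .perm (setIndex F t s).symm]

/-- The register of the tree index, split off the others. -/
def treeSplit (F : Fin n → DTree d g A) (t : ℕ) : ForestBasis F t ≃
    (Fin d × A × Fin t × (Fin (forestHeight F) → Fin g) × Fin 2) × Fin n where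
  toFun b := ((b.1, b.2.1, b.2.2.count, b.2.2.path, b.2.2.out), b.2.2.tree)
  invFun k := (k.1.1, k.1.2.1, ⟨k.1.2.2.1, k.2, k.1.2.2.2.1, k.1.2.2.2.2⟩)
  left_inv _ := rfl
  right_inv _ := rfl

/-- The counting register, split off the others. -/
def countSplit (F : Fin n → DTree d g A) (t : ℕ) : ForestBasis F t ≃
    (Fin d × A × Fin n × (Fin (forestHeight F) → Fin g) × Fin 2) × Fin t where
  toFun b := ((b.1, b.2.1, b.2.2.tree, b.2.2.path, b.2.2.out), b.2.2.count)
  invFun k := (k.1.1, k.1.2.1, ⟨k.2, k.1.2.2.1, k.1.2.2.2.1, k.1.2.2.2.2⟩)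
  left_inv _ := rfl
  right_inv _ := rfl

/-- The output qubit, split off the others. -/
def outSplit (F : Fin n → DTree d g A) (t : ℕ) : ForestBasis F t ≃
    (Fin d × A × Fin t × Fin n × (Fin (forestHeight F) → Fin g)) × Fin 2 where
  toFun b := ((b.1, b.2.1, b.2.2.count, b.2.2.tree, b.2.2.path), b.2.2.out)
  invFun k := (k.1.1, k.1.2.1, ⟨k.1.2.2.1, k.1.2.2.2.1, k.1.2.2.2.2, k.2⟩)
  left_inv _ := rfl
  right_inv _ := rfl

/-- The angle `arcsin √((y - y_min) / (y_max - y_min))` for a leaf label `y`. -/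
noncomputable def leafAngle [NeZero g] [NeZero n] (F : Fin n → DTree d g A) (y : ℝ) : ℝ :=
  Real.arcsin (Real.sqrt ((y - yMin F) / (yMax F - yMin F)))

/-- The rotation of the output qubit according to the label of the leaf in the node register. -/
noncomputable def rotateOut [NeZero g] [NeZero n] (F : Fin n → DTree d g A) (t : ℕ) :
    Instr d A (ForestWork t n (forestHeight F) g) :=
  .ucg (outSplit F t) fun k => rot (leafAngle F
    (nodeAt (F k.2.2.2.1) k.2.2.2.2 (forestHeight F)).label)

/-- The circuit `𝒰`: apply `H` to the register of the tree index (to prepare the uniform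
superposition), walk all the trees down, rotate the output qubit. Here `H` may be any unitary with
`H|0⟩ = (1/√n) ∑ |i⟩`: Hadamard gates on all the qubits if `n` is a power of two, or `dft n`. -/
noncomputable def forestCircuit [NeZero d] [NeZero g] [NeZero n] (F : Fin n → DTree d g A)
    (H : Matrix.unitaryGroup (Fin n) ℂ) (t : ℕ) : ForestCircuit F t :=
  [.ucg (treeSplit F t) fun _ => H] ++ (List.finRange (forestHeight F)).flatMap (walkStep F t) ++
    [rotateOut F t]

/-- `V = I - 2P`, where `P` projects onto output qubit `1`, applied if the counter exceeds `s`. -/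
def controlledV (F : Fin n → DTree d g A) (t s : ℕ) :
    Instr d A (ForestWork t n (forestHeight F) g) :=
  .flip fun b => if s < (b.2.2.count : ℕ) ∧ b.2.2.out = 1 then -1 else 1

open Classical in
/-- `2|0⟩⟨0| - I` on all registers but the counter, applied if the counter exceeds `s`. -/
noncomputable def controlledZero [NeZero d] [NeZero g] [NeZero n] [AddCommGroup A]
    (F : Fin n → DTree d g A) (t s : ℕ) : Instr d A (ForestWork t n (forestHeight F) g) :=
  .flip fun b => if s < (b.2.2.count : ℕ) ∧
    ¬ (b.1 = 0 ∧ b.2.1 = 0 ∧ b.2.2.tree = 0 ∧ (∀ r, b.2.2.path r = 0) ∧ b.2.2.out = 0)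
    then -1 else 1

/-- `D V` with `D = 2|Ψ⟩⟨Ψ| - I = 𝒰 (2|0⟩⟨0| - I) 𝒰⁻¹`, applied if the counter exceeds `s`. -/
noncomputable def groverStep [NeZero d] [NeZero g] [NeZero n] [AddCommGroup A]
    (F : Fin n → DTree d g A) (H : Matrix.unitaryGroup (Fin n) ℂ) (t s : ℕ) : ForestCircuit F t :=
  [controlledV F t s] ++ (forestCircuit F H t).inv ++ [controlledZero F t s] ++ forestCircuit F H t

/-- Amplitude estimation with parameter `t` for `|Ψ⟩ = 𝒰|0⟩` and `P`: prepare `|Ψ⟩` and the uniform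
superposition of the counter values `k < t`, apply `D V` controlled by the counter (`k` times for
the counter value `k`), and apply the inverse Fourier transform to the counter. -/
noncomputable def estimationCircuit [NeZero d] [NeZero g] [NeZero n] [AddCommGroup A]
    (F : Fin n → DTree d g A) (H : Matrix.unitaryGroup (Fin n) ℂ) (t : ℕ) : ForestCircuit F t :=
  forestCircuit F H t ++ [.ucg (countSplit F t) fun _ => dft t] ++
    (List.range (t - 1)).flatMap (groverStep F H t) ++
    [.ucg (countSplit F t) fun _ => (dft t)⁻¹]

/-- The law of the measured counter value of one amplitude estimation for the input `X`. -/
noncomputable def counterLaw [NeZero d] [NeZero g] [NeZero n] [AddCommGroup A]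
    (F : Fin n → DTree d g A) (H : Matrix.unitaryGroup (Fin n) ℂ) (t : ℕ) [NeZero t]
    (X : Fin d → A) : PMF (Fin t) :=
  ((estimationCircuit F H t).measure X (zeroLabel F t)).map fun b => b.2.2.count

/-- The joint law of the measured counter values of `m` independent amplitude estimations. -/
noncomputable def runsLaw [NeZero d] [NeZero g] [NeZero n] [AddCommGroup A]
    (F : Fin n → DTree d g A) (H : Matrix.unitaryGroup (Fin n) ℂ) (t : ℕ) [NeZero t]
    (m : ℕ) (X : Fin d → A) : Measure (Fin m → Fin t) :=
  Measure.pi fun _ => (counterLaw F H t X).toMeasure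

/-- The number of queries of `m` amplitude estimations. -/
noncomputable def runsQueries [NeZero d] [NeZero g] [NeZero n] [AddCommGroup A]
    (F : Fin n → DTree d g A) (H : Matrix.unitaryGroup (Fin n) ℂ) (t m : ℕ) : ℕ :=
  m * (estimationCircuit F H t).queries

end Algorithm

/-- The median of `m` numbers: entry number `⌊m / 2⌋` (counted from `0`) after sorting. -/
noncomputable def median {m : ℕ} (v : Fin m → ℝ) : ℝ :=
  if hm : 0 < m then v (Tuple.sort v ⟨m / 2, Nat.div_lt_self hm one_lt_two⟩) else 0

/-- The estimate `β̃` of the algorithm: the median of the estimates `sin² (π y / t)` for the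
measured counter values `y`. -/
noncomputable def betaEstimate {m t : ℕ} (ys : Fin m → Fin t) : ℝ :=
  median fun k => Real.sin (Real.pi * ((ys k : ℕ) : ℝ) / (t : ℝ)) ^ 2

/-- The estimate `R̃ = y_min + (y_max - y_min) β̃` of the algorithm. -/
noncomputable def forecastEstimate {d g n : ℕ} {A : Type} [NeZero g] [NeZero n]
    (F : Fin n → DTree d g A) {m t : ℕ} (ys : Fin m → Fin t) : ℝ :=
  yMin F + (yMax F - yMin F) * betaEstimate ys

/-! The state space may be infinite-dimensional, because the value register ranges over the group
`A`, but the algorithm started in the zero label only meets superpositions of finitely many known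
labels. The walk takes each `rootLabel` to a `leafLabel` and returns the index and value registers
to zero, since every look-up is undone. Between these two families of labels `𝒰` is therefore a
finite unitary matrix on tree index and output qubit (`run_forestCircuit`, `forestMatrix_mem`),
whose column at zero is `|Ψ⟩`.

Since the mean of `sin² α_i` is `β`, one has `|Ψ⟩ = cos θ |b⟩|0⟩ + sin θ |c⟩|1⟩` with unit vectors
`b`, `c` and `sin² θ = β` (`exists_isGroverPlane`). In this plane `V` sends the angle `φ` to `-φ`
and `D` reflects in the direction `θ`, so `D V` is the rotation by `2θ` (`run_groverStep`). The
counter value `k` ends up with the angle `(2k + 1)θ`, and the inverse Fourier transform turns this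
into a geometric series: the outcome `y` has as probability the mean of the Fejér kernels centred at
`θ` and `-θ` (`counterLaw_apply`). The grid points `π y / t` next to the centre carry at least
`79/100` of each kernel (`sum_fejer_ge`), and `sin²`, which does not distinguish `θ` from `-θ`,
differs there from `β` by at most the claimed error (`counterLaw_good_ge`).

As the failure probability `21/100` is below `1/4`, the union bound over the `r`-subsets of `2r`
runs gives failure at most `(84/100)^r` for the median, so `r` of order `log (1/δ)` suffices. Each
run makes at most `4 t h` queries. The statement for `R` follows by scaling with `y_max - y_min`. -/

set_option linter.unusedSectionVars false

/-! ## Linearity and invertibility of circuits -/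

section CircuitAlgebra

variable {d : ℕ} {A W : Type} [AddCommGroup A]

/-- The action of an instruction as a linear map. -/
noncomputable def Instr.applyLin (X : Fin d → A) (I : Instr d A W) :
    (QBasis d A W → ℂ) →ₗ[ℂ] (QBasis d A W → ℂ) where
  toFun := I.apply X
  map_add' ψ φ := by
    cases I with
    | flip s => funext b; simp [Instr.apply, mul_add]
    | ucg e M => funext b; simp [Instr.apply, mul_add, Finset.sum_add_distrib]
    | _ => rfl
  map_smul' c ψ := by
    cases I with
    | flip s => funext b; simp [Instr.apply, mul_left_comm]
    | ucg e M => funext b; simp [Instr.apply, mul_left_comm, Finset.mul_sum]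
    | _ => rfl

theorem Instr.inv_apply_apply (X : Fin d → A) (I : Instr d A W) (ψ : QBasis d A W → ℂ) :
    I.inv.apply X (I.apply X ψ) = ψ := by
  cases I with
  | perm σ => funext b; simp [Instr.apply, Instr.inv]
  | flip s =>
    funext b
    rcases Int.units_eq_one_or (s b) with h | h <;> simp [Instr.apply, Instr.inv, h]
  | @ucg K T _ _ e M =>
    funext b
    obtain ⟨⟨k, a⟩, rfl⟩ := e.symm.surjective b
    have h : ((M k)⁻¹ : Matrix.unitaryGroup T ℂ).1 *ᵥ ((M k).1 *ᵥ fun c => ψ (e.symm (k, c))) =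
        fun c => ψ (e.symm (k, c)) := by
      rw [Matrix.mulVec_mulVec, ← Matrix.UnitaryGroup.mul_val, inv_mul_cancel,
        Matrix.UnitaryGroup.one_val, Matrix.one_mulVec]
    simpa [Instr.apply, Instr.inv, Matrix.mulVec, dotProduct] using congrFun h a
  | query => funext b; simp [Instr.apply, Instr.inv]
  | queryInv => funext b; simp [Instr.apply, Instr.inv]

namespace Circuit

theorem run_append (X : Fin d → A) (c c' : Circuit d A W) (ψ : QBasis d A W → ℂ) :
    Circuit.run X (c ++ c') ψ = c'.run X (c.run X ψ) := List.foldl_append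

@[simp] theorem run_nil (X : Fin d → A) (ψ : QBasis d A W → ℂ) :
    Circuit.run X ([] : Circuit d A W) ψ = ψ := rfl

@[simp] theorem run_cons (X : Fin d → A) (I : Instr d A W) (c : Circuit d A W)
    (ψ : QBasis d A W → ℂ) : Circuit.run X (I :: c) ψ = c.run X (I.apply X ψ) := rfl

/-- The action of a circuit as a linear map. -/
noncomputable def runLin (X : Fin d → A) (c : Circuit d A W) :
    (QBasis d A W → ℂ) →ₗ[ℂ] (QBasis d A W → ℂ) :=
  c.foldl (fun f I => I.applyLin X ∘ₗ f) LinearMap.id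

theorem runLin_apply (X : Fin d → A) (c : Circuit d A W) (ψ : QBasis d A W → ℂ) :
    c.runLin X ψ = c.run X ψ := by
  have h : ∀ (c : Circuit d A W) (f : (QBasis d A W → ℂ) →ₗ[ℂ] (QBasis d A W → ℂ)),
      c.foldl (fun f I => I.applyLin X ∘ₗ f) f ψ = c.run X (f ψ) := by
    intro c
    induction c with
    | nil => intro f; rfl
    | cons I c ih => intro f; exact ih _
  exact h c _

theorem run_sum {ι : Type} (s : Finset ι) (X : Fin d → A) (c : Circuit d A W)
    (ψ : ι → QBasis d A W → ℂ) : c.run X (∑ x ∈ s, ψ x) = ∑ x ∈ s, c.run X (ψ x) := by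
  simp only [← runLin_apply, map_sum]

theorem run_smul (X : Fin d → A) (c : Circuit d A W) (z : ℂ)
    (ψ : QBasis d A W → ℂ) : c.run X (z • ψ) = z • c.run X ψ := by
  simp only [← runLin_apply, map_smul]

theorem inv_run_run (X : Fin d → A) (c : Circuit d A W) (ψ : QBasis d A W → ℂ) :
    c.inv.run X (c.run X ψ) = ψ := by
  induction c generalizing ψ with
  | nil => rfl
  | cons I c ih =>
    have h : Circuit.inv (I :: c) = Circuit.inv c ++ [I.inv] := by simp [Circuit.inv]
    rw [h, run_append, run_cons, run_cons, ih, run_nil, Instr.inv_apply_apply]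

/-- The loop rule: `ψ s` is the invariant that holds before round `s`. -/
theorem run_flatMap_finRange (X : Fin d → A) {h : ℕ} (f : Fin h → Circuit d A W)
    (ψ : ℕ → QBasis d A W → ℂ) (hψ : ∀ s : Fin h, (f s).run X (ψ s) = ψ (s + 1)) :
    Circuit.run X ((List.finRange h).flatMap f) (ψ 0) = ψ h := by
  induction h with
  | zero => rfl
  | succ h ih =>
    rw [List.finRange_succ_last, List.flatMap_append, List.flatMap_map, run_append,
      ih (fun s => f s.castSucc) fun s => by simpa using hψ s.castSucc]
    simpa using hψ (Fin.last h)

theorem run_flatMap_range (X : Fin d → A) {h : ℕ} (f : ℕ → Circuit d A W)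
    (ψ : ℕ → QBasis d A W → ℂ) (hψ : ∀ s, (f s).run X (ψ s) = ψ (s + 1)) :
    Circuit.run X ((List.range h).flatMap f) (ψ 0) = ψ h := by
  induction h with
  | zero => rfl
  | succ h ih => rw [List.range_succ, List.flatMap_append, run_append, ih]; simpa using hψ h

end Circuit

end CircuitAlgebra

/-! ### Counting queries -/

section QueryCount

variable {d : ℕ} {A W : Type}

theorem Instr.queries_inv (I : Instr d A W) : I.inv.queries = I.queries := by
  cases I <;> rfl

namespace Circuit

theorem queries_append (c c' : Circuit d A W) :
    Circuit.queries (c ++ c') = c.queries + c'.queries := by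
  simp [Circuit.queries]

theorem queries_inv (c : Circuit d A W) : c.inv.queries = c.queries := by
  have h : Instr.queries ∘ Instr.inv = (Instr.queries : Instr d A W → ℕ) :=
    funext Instr.queries_inv
  simp [Circuit.queries, Circuit.inv, List.sum_reverse, h]

theorem queries_flatMap {ι : Type} (l : List ι) (f : ι → Circuit d A W) (q : ℕ)
    (h : ∀ s, (f s).queries = q) : Circuit.queries (l.flatMap f) = l.length * q := by
  induction l with
  | nil => simp [Circuit.queries]
  | cons s l ih => rw [List.flatMap_cons, queries_append, ih, h, List.length_cons]; ring

end Circuit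

end QueryCount

/-! ## Superpositions of finitely many basis states -/

section Superposition

/-- The state `∑ x, w x |ℓ x⟩`. -/
noncomputable def superpose {ι κ : Type} [Fintype ι] (l : ι → κ) (w : ι → ℂ) : κ → ℂ :=
  ∑ x, w x • ket (l x)

theorem superpose_smul {ι κ : Type} [Fintype ι] (l : ι → κ) (z : ℂ) (w : ι → ℂ) :
    superpose l (z • w) = z • superpose l w := by
  simp [superpose, Finset.smul_sum, mul_smul]

theorem superpose_sum {ι κ σ : Type} [Fintype ι] (s : Finset σ) (l : ι → κ) (w : σ → ι → ℂ) :
    superpose l (∑ y ∈ s, w y) = ∑ y ∈ s, superpose l (w y) := by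
  simp only [superpose, Finset.sum_apply, Finset.sum_smul]
  exact Finset.sum_comm

theorem ket_apply {κ : Type} (b c : κ) [Decidable (c = b)] :
    ket b c = if c = b then 1 else 0 := by
  classical
  unfold ket; rw [Pi.single_apply]; congr

theorem superpose_apply_label {ι κ : Type} [Fintype ι] {l : ι → κ} (hl : l.Injective)
    (w : ι → ℂ) (x : ι) : superpose l w (l x) = w x := by
  classical
  simp [superpose, ket_apply, hl.eq_iff]

theorem superpose_apply_of_notMem {ι κ : Type} [Fintype ι] {l : ι → κ} (w : ι → ℂ) {b : κ}
    (hb : b ∉ Set.range l) : superpose l w b = 0 := by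
  classical
  have h : ∀ x, b ≠ l x := fun x h => hb ⟨x, h.symm⟩
  simp [superpose, ket_apply, h]

variable {d : ℕ} {A W : Type} [AddCommGroup A]

theorem Circuit.run_superpose {ι : Type} [Fintype ι] (X : Fin d → A) (c : Circuit d A W)
    (l : ι → QBasis d A W) (w : ι → ℂ) :
    c.run X (superpose l w) = ∑ x, w x • c.run X (ket (l x)) := by
  rw [superpose, Circuit.run_sum]
  exact Finset.sum_congr rfl fun x _ => Circuit.run_smul ..

/-- Linearity reduces a circuit to a finite matrix `M` once its action on the labelled basis states
is known; the rest of the state space plays no role. -/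
theorem Circuit.run_superpose_mulVec {ι ι' : Type} [Fintype ι] [Fintype ι'] (X : Fin d → A)
    {c : Circuit d A W} {l : ι → QBasis d A W} {l' : ι' → QBasis d A W} {M : Matrix ι' ι ℂ}
    (h : ∀ x, c.run X (ket (l x)) = superpose l' fun x' => M x' x) (w : ι → ℂ) :
    c.run X (superpose l w) = superpose l' (M *ᵥ w) := by
  rw [Circuit.run_superpose]
  simp_rw [h, ← superpose_smul, ← superpose_sum]
  congr 1
  funext x'
  simp [Matrix.mulVec, dotProduct, mul_comm]

/-- A left inverse of the circuit is enough: unitarity gives `w = M (M* w)`, so the given state is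
the image under `c` of the superposition with amplitudes `M* w`. -/
theorem Circuit.run_inv_superpose {ι : Type} [Fintype ι] [DecidableEq ι] (X : Fin d → A)
    {c : Circuit d A W} {l l' : ι → QBasis d A W} {M : Matrix ι ι ℂ}
    (hM : M ∈ Matrix.unitaryGroup ι ℂ)
    (h : ∀ x, c.run X (ket (l x)) = superpose l' fun x' => M x' x) (w : ι → ℂ) :
    c.inv.run X (superpose l' w) = superpose l (star M *ᵥ w) := by
  have h1 : w = M *ᵥ (star M *ᵥ w) := by
    rw [Matrix.mulVec_mulVec, (Matrix.mem_unitaryGroup_iff).1 hM, Matrix.one_mulVec]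
  conv_lhs => rw [h1, ← Circuit.run_superpose_mulVec X h, Circuit.inv_run_run]

theorem Instr.flip_superpose {ι : Type} [Fintype ι] (X : Fin d → A)
    (s : QBasis d A W → ℤˣ) (l : ι → QBasis d A W) (w : ι → ℂ) :
    (Instr.flip s : Instr d A W).apply X (superpose l w) =
      superpose l fun x => ((s (l x) : ℤ) : ℂ) * w x := by
  classical
  funext b
  simp only [Instr.apply, superpose, Finset.sum_apply, Pi.smul_apply, smul_eq_mul, Finset.mul_sum,
    ket_apply]
  refine Finset.sum_congr rfl fun x _ => ?_
  split_ifs with hb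
  · subst hb; ring
  · simp

theorem Instr.ucg_ket {K T : Type} [Fintype T] [DecidableEq T] (X : Fin d → A)
    (e : QBasis d A W ≃ K × T) (M : K → Matrix.unitaryGroup T ℂ) (b : QBasis d A W) :
    (Instr.ucg e M : Instr d A W).apply X (ket b) =
      ∑ c, (M (e b).1 : Matrix T T ℂ) c (e b).2 • ket (e.symm ((e b).1, c)) := by
  classical
  obtain ⟨⟨k, a⟩, rfl⟩ := e.symm.surjective b
  funext b'
  obtain ⟨⟨k', a'⟩, rfl⟩ := e.symm.surjective b'
  by_cases hk : k' = k
  · subst hk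
    simp [Instr.apply, ket_apply]
  · simp [Instr.apply, ket_apply, hk]

theorem Instr.perm_ket (X : Fin d → A) (σ : Equiv.Perm (QBasis d A W)) (b : QBasis d A W) :
    (Instr.perm σ : Instr d A W).apply X (ket b) = ket (σ b) := by
  classical
  funext c
  simp [Instr.apply, ket_apply, Equiv.symm_apply_eq]

theorem Instr.query_ket (X : Fin d → A) (j : Fin d) (z : A) (w : W) :
    (Instr.query : Instr d A W).apply X (ket (j, z, w)) = ket (j, z + X j, w) := by
  classical
  funext ⟨j', z', w'⟩
  simp only [Instr.apply, ket_apply, Prod.mk.injEq]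
  by_cases hj : j' = j
  · subst hj; simp [sub_eq_iff_eq_add]
  · simp [hj]

theorem Instr.queryInv_ket (X : Fin d → A) (j : Fin d) (z : A) (w : W) :
    (Instr.queryInv : Instr d A W).apply X (ket (j, z, w)) = ket (j, z - X j, w) := by
  classical
  funext ⟨j', z', w'⟩
  simp only [Instr.apply, ket_apply, Prod.mk.injEq]
  by_cases hj : j' = j
  · subst hj; simp [eq_sub_iff_add_eq]
  · simp [hj]

end Superposition

/-! ## The walk from the root to a leaf -/

namespace DTree

variable {d g : ℕ} {A : Type}

/-- The child of the root to which the object `X` leads (the tree itself if it is a leaf). -/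
def next (X : Fin d → A) : DTree d g A → DTree d g A
  | leaf y => leaf y
  | node j test child => child (test (X j))

theorem eval_next (X : Fin d → A) (T : DTree d g A) : (T.next X).eval X = T.eval X := by
  cases T <;> rfl

theorem height_next_le (X : Fin d → A) (T : DTree d g A) : (T.next X).height ≤ T.height - 1 := by
  cases T with
  | leaf y => simp [next, height]
  | node j test child =>
    simpa [next, height] using Finset.le_sup (f := fun b => (child b).height)
      (Finset.mem_univ (test (X j)))

theorem eval_iterate_next (X : Fin d → A) (T : DTree d g A) (s : ℕ) :
    ((next X)^[s] T).eval X = T.eval X := by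
  induction s with
  | zero => rfl
  | succ s ih => rw [Function.iterate_succ_apply', eval_next, ih]

theorem height_iterate_next_le (X : Fin d → A) (T : DTree d g A) (s : ℕ) :
    ((next X)^[s] T).height ≤ T.height - s := by
  induction s with
  | zero => simp
  | succ s ih =>
    rw [Function.iterate_succ_apply']
    have := height_next_le X ((next X)^[s] T)
    omega

/-- Each step lowers the height until it is zero and preserves the result; a tree of height zero is
a leaf. -/
theorem iterate_next_eq_leaf (X : Fin d → A) (T : DTree d g A) {s : ℕ} (hs : T.height ≤ s) :
    (next X)^[s] T = leaf (T.eval X) := by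
  have h1 := eval_iterate_next X T s
  have h2 := height_iterate_next_le X T s
  cases h : (next X)^[s] T with
  | leaf y => rw [h, eval] at h1; rw [h1]
  | node j test child => rw [h, height] at h2; omega

theorem descend_append (T : DTree d g A) (l l' : List (Fin g)) :
    T.descend (l ++ l') = (T.descend l).descend l' := by
  induction l generalizing T with
  | nil => simp [descend]
  | cons b l ih =>
    cases T with
    | leaf y => cases l' <;> simp [descend]
    | node j test child => simpa [descend] using ih (child b)

theorem descend_outcome [NeZero d] [NeZero g] (X : Fin d → A) (T : DTree d g A) :
    T.descend [T.outcome (X T.attr)] = T.next X := by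
  cases T <;> simp [descend, outcome, attr, next]

/-- The first `s` digits of the address of the leaf reached on `X`; the other digits are `0`. -/
def walkPath [NeZero d] [NeZero g] (X : Fin d → A) (T : DTree d g A) (h s : ℕ) : Fin h → Fin g :=
  fun r => if (r : ℕ) < s then ((next X)^[r] T).outcome (X ((next X)^[r] T).attr) else 0

theorem walkPath_zero [NeZero d] [NeZero g] (X : Fin d → A) (T : DTree d g A) (h : ℕ) :
    T.walkPath X h 0 = fun _ => 0 := by
  funext r; simp [walkPath]

/-- The number `m` of digits read is kept apart from the number `s` of digits written: the walk
needs this with `m = s` before a move and with one more digit written after it. -/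
theorem nodeAt_walkPath [NeZero d] [NeZero g] (X : Fin d → A) (T : DTree d g A) {h s m : ℕ}
    (hms : m ≤ s) (hmh : m ≤ h) : nodeAt T (T.walkPath X h s) m = (next X)^[m] T := by
  induction m with
  | zero => simp [nodeAt, descend]
  | succ m ih =>
    have h1 : nodeAt T (T.walkPath X h s) (m + 1) =
        (nodeAt T (T.walkPath X h s) m).descend [T.walkPath X h s ⟨m, hmh⟩] := by
      rw [nodeAt, nodeAt, ← descend_append]
      congr 1
      rw [List.take_add_one, List.getElem?_eq_getElem (by simpa using hmh)]
      simp
    rw [h1, ih (by omega) (by omega), Function.iterate_succ_apply', ← descend_outcome, walkPath,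
      if_pos (by simpa using hms)]

theorem update_walkPath [NeZero d] [NeZero g] (X : Fin d → A) (T : DTree d g A) {h : ℕ}
    (s : Fin h) :
    Function.update (T.walkPath X h s) s (T.walkPath X h s s +
      ((next X)^[s] T).outcome (X ((next X)^[s] T).attr)) = T.walkPath X h (s + 1) := by
  -- Digit `s` is still `0` before the move, so adding the outcome writes it.
  funext r
  by_cases hr : r = s
  · subst hr; simp [walkPath]
  · have h1 : (r : ℕ) ≠ s := fun h => hr (Fin.ext h)
    have h2 : (r : ℕ) < s + 1 ↔ (r : ℕ) < s := by omega
    simp [walkPath, hr, h2]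

end DTree

/-! ## The circuit `𝒰` -/

section ForestCircuit

variable {d g n : ℕ} {A : Type} [NeZero d] [NeZero g]

/-- The address of the leaf of the `i`-th tree reached on `X`. -/
def leafPath (F : Fin n → DTree d g A) (X : Fin d → A) (i : Fin n) :
    Fin (forestHeight F) → Fin g :=
  (F i).walkPath X (forestHeight F) (forestHeight F)

theorem nodeAt_leafPath (F : Fin n → DTree d g A) (X : Fin d → A) (i : Fin n) :
    nodeAt (F i) (leafPath F X i) (forestHeight F) = DTree.leaf ((F i).eval X) := by
  rw [leafPath, DTree.nodeAt_walkPath X _ le_rfl le_rfl]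
  exact DTree.iterate_next_eq_leaf X _ (Finset.le_sup (f := fun i => (F i).height)
    (Finset.mem_univ i))

theorem queries_forestCircuit [NeZero n] (F : Fin n → DTree d g A) (H : Matrix.unitaryGroup (Fin n) ℂ)
    (t : ℕ) : (forestCircuit F H t).queries = 2 * forestHeight F := by
  have h : ∀ s, (walkStep F t s).queries = 2 := fun s => rfl
  rw [forestCircuit, Circuit.queries_append, Circuit.queries_append,
    Circuit.queries_flatMap _ _ 2 h]
  simp [Circuit.queries, Instr.queries, rotateOut, mul_comm]

variable [AddCommGroup A]

/-- The basis label with counter `k`, tree index `x.1`, output qubit `x.2`, and the other registers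
zero. -/
def rootLabel (F : Fin n → DTree d g A) {t : ℕ} (k : Fin t) (x : Fin n × Fin 2) :
    ForestBasis F t := (0, 0, ⟨k, x.1, fun _ => 0, x.2⟩)

/-- The basis label with counter `k`, tree index `x.1`, the address of the leaf that this tree
reaches on `X`, and output qubit `x.2`. -/
def leafLabel (F : Fin n → DTree d g A) (X : Fin d → A) {t : ℕ} (k : Fin t) (x : Fin n × Fin 2) :
    ForestBasis F t := (0, 0, ⟨k, x.1, leafPath F X x.1, x.2⟩)

theorem leafLabel_injective (F : Fin n → DTree d g A) (X : Fin d → A) {t : ℕ} :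
    Function.Injective fun x : Fin t × (Fin n × Fin 2) => leafLabel F X x.1 x.2 := by
  rintro ⟨k, i, o⟩ ⟨k', i', o'⟩ h
  simp only [leafLabel, Prod.mk.injEq, ForestWork.mk.injEq, true_and] at h
  simp [h.1, h.2.1, h.2.2.2]

theorem run_walkStep (F : Fin n → DTree d g A) (X : Fin d → A) {t : ℕ} (k : Fin t) (i : Fin n)
    (o : Fin 2) (s : Fin (forestHeight F)) :
    (walkStep F t s).run X
        (ket (0, 0, ⟨k, i, (F i).walkPath X (forestHeight F) s, o⟩)) =
      ket ((0, 0, ⟨k, i, (F i).walkPath X (forestHeight F) (s + 1), o⟩) : ForestBasis F t) := by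
  have h1 := DTree.nodeAt_walkPath X (F i) (le_refl (s : ℕ)) s.2.le
  -- The move writes only digit `s`, so the first `s` digits still address the old node. This is why
  -- the inverse query and the inverse of `setIndex` clear their registers.
  have h2 := DTree.nodeAt_walkPath X (F i) (Nat.le_succ (s : ℕ)) s.2.le
  simp only [walkStep, Circuit.run_cons, Circuit.run_nil, Instr.perm_ket]
  rw [show setIndex F t s (0, 0, ⟨k, i, (F i).walkPath X (forestHeight F) s, o⟩) =
      (((DTree.next X)^[s] (F i)).attr, 0, ⟨k, i, (F i).walkPath X (forestHeight F) s, o⟩) by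
    simp [setIndex, h1], Instr.query_ket, Instr.perm_ket, zero_add]
  rw [show moveDown F t s (((DTree.next X)^[s] (F i)).attr, X ((DTree.next X)^[s] (F i)).attr,
        ⟨k, i, (F i).walkPath X (forestHeight F) s, o⟩) =
      (((DTree.next X)^[s] (F i)).attr, X ((DTree.next X)^[s] (F i)).attr,
        ⟨k, i, (F i).walkPath X (forestHeight F) (s + 1), o⟩) by
    simp [moveDown, h1, DTree.update_walkPath], Instr.queryInv_ket, Instr.perm_ket, sub_self]
  congr 1
  simp [setIndex, h2]

theorem run_walk (F : Fin n → DTree d g A) (X : Fin d → A) {t : ℕ} (k : Fin t)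
    (x : Fin n × Fin 2) :
    Circuit.run X ((List.finRange (forestHeight F)).flatMap (walkStep F t)) (ket (rootLabel F k x))
      = ket (leafLabel F X k x) := by
  have h := Circuit.run_flatMap_finRange X (walkStep F t) (fun s =>
    ket ((0, 0, ⟨k, x.1, (F x.1).walkPath X (forestHeight F) s, x.2⟩) : ForestBasis F t))
    (run_walkStep F X k x.1 x.2)
  simp only [DTree.walkPath_zero] at h
  exact h

variable [NeZero n]

/-- The angle of the rotation for the leaf that the `i`-th tree reaches on `X`. -/
noncomputable def treeAngle (F : Fin n → DTree d g A) (X : Fin d → A) (i : Fin n) : ℝ :=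
  leafAngle F ((F i).eval X)

/-- The matrix of `𝒰` on the tree index and the output qubit. -/
noncomputable def forestMatrix (F : Fin n → DTree d g A) (H : Matrix.unitaryGroup (Fin n) ℂ)
    (X : Fin d → A) : Matrix (Fin n × Fin 2) (Fin n × Fin 2) ℂ :=
  Matrix.of fun x' x => (H : Matrix _ _ ℂ) x'.1 x.1 * rotMatrix (treeAngle F X x'.1) x'.2 x.2

/-- The matrix is `H` on the tree index followed by rotations controlled by it. In `M M*` the block
`(i, i')` is the entry of `H H*` times a product of rotations, so it vanishes off the diagonal and
is the identity on it. -/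
theorem forestMatrix_mem (F : Fin n → DTree d g A) (H : Matrix.unitaryGroup (Fin n) ℂ)
    (X : Fin d → A) : forestMatrix F H X ∈ Matrix.unitaryGroup (Fin n × Fin 2) ℂ := by
  rw [Matrix.mem_unitaryGroup_iff]
  ext ⟨i, o⟩ ⟨i', o'⟩
  have hH := congrFun (congrFun (((Matrix.mem_unitaryGroup_iff).1 H.2 :)) i) i'
  have h1 : (forestMatrix F H X * star (forestMatrix F H X)) (i, o) (i', o') =
      ((H : Matrix (Fin n) (Fin n) ℂ) * star (H : Matrix (Fin n) (Fin n) ℂ)) i i' *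
        (rotMatrix (treeAngle F X i) * star (rotMatrix (treeAngle F X i'))) o o' := by
    simp only [Matrix.mul_apply, Finset.sum_mul_sum, Fintype.sum_prod_type, forestMatrix,
      Matrix.of_apply, Matrix.star_apply, star_mul']
    exact Finset.sum_congr rfl fun a _ => Finset.sum_congr rfl fun b _ => by ring
  rw [h1, hH]
  by_cases hi : i = i'
  · subst hi
    rw [(Matrix.mem_unitaryGroup_iff).1 (rotMatrix_mem _)]
    simp [Matrix.one_apply]
  · simp [hi]

theorem apply_rotateOut (F : Fin n → DTree d g A) (X : Fin d → A) {t : ℕ} (k : Fin t)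
    (x : Fin n × Fin 2) :
    (rotateOut F t).apply X (ket (leafLabel F X k x)) =
      ∑ o, rotMatrix (treeAngle F X x.1) o x.2 • ket (leafLabel F X k (x.1, o)) := by
  rw [rotateOut, Instr.ucg_ket]
  simp only [outSplit, leafLabel, Equiv.coe_fn_mk, Equiv.coe_fn_symm_mk, nodeAt_leafPath, rot,
    DTree.label, treeAngle]

theorem run_forestCircuit (F : Fin n → DTree d g A) (H : Matrix.unitaryGroup (Fin n) ℂ)
    (X : Fin d → A) {t : ℕ} (k : Fin t) (x : Fin n × Fin 2) :
    (forestCircuit F H t).run X (ket (rootLabel F k x)) =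
      superpose (leafLabel F X k) fun x' => forestMatrix F H X x' x := by
  have h1 : (Instr.ucg (treeSplit F t) fun _ => H).apply X (ket (rootLabel F k x)) =
      ∑ i, (H : Matrix _ _ ℂ) i x.1 • ket (rootLabel F k (i, x.2)) := by
    rw [Instr.ucg_ket]; rfl
  rw [forestCircuit, List.append_assoc, List.singleton_append, Circuit.run_cons, h1,
    Circuit.run_sum]
  simp only [Circuit.run_smul, Circuit.run_append, run_walk, Circuit.run_cons, Circuit.run_nil,
    apply_rotateOut]
  simp only [superpose, Fintype.sum_prod_type, Finset.smul_sum, forestMatrix, Matrix.of_apply,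
    mul_smul]

end ForestCircuit

/-! ## Amplitude estimation -/

section Estimation

variable {d g n : ℕ} {A : Type} [NeZero d] [NeZero g] [NeZero n]

/-- The amplitudes `cos φ · b` (output qubit `0`) and `sin φ · c` (output qubit `1`). -/
noncomputable def planeVector (b c : Fin n → ℝ) (φ : ℝ) (x : Fin n × Fin 2) : ℂ :=
  if x.2 = 0 then (Real.cos φ * b x.1 : ℝ) else (Real.sin φ * c x.1 : ℝ)

/-- The unit vectors `b` and `c` span a plane that contains `|Ψ⟩`, at the angle `θ` to `b`. -/
structure IsGroverPlane (F : Fin n → DTree d g A) (X : Fin d → A) (b c : Fin n → ℝ) (θ : ℝ) :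
    Prop where
  sum_sq_left : ∑ i, b i ^ 2 = 1
  sum_sq_right : ∑ i, c i ^ 2 = 1
  cos_eq : ∀ i, Real.cos (treeAngle F X i) / Real.sqrt n = Real.cos θ * b i
  sin_eq : ∀ i, Real.sin (treeAngle F X i) / Real.sqrt n = Real.sin θ * c i

variable [AddCommGroup A]

theorem forestMatrix_zero {F : Fin n → DTree d g A} {H : Matrix.unitaryGroup (Fin n) ℂ}
    (hH : ∀ i, (H : Matrix (Fin n) (Fin n) ℂ) i 0 = 1 / (Real.sqrt n : ℂ)) {X : Fin d → A}
    {b c : Fin n → ℝ} {θ : ℝ} (hp : IsGroverPlane F X b c θ) (x : Fin n × Fin 2) :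
    forestMatrix F H X x 0 = planeVector b c θ x := by
  obtain ⟨i, o⟩ := x
  fin_cases o
  · simp [forestMatrix, planeVector, rotMatrix, hH, -Complex.ofReal_mul, -Complex.ofReal_cos,
      ← hp.cos_eq]
    ring
  · simp [forestMatrix, planeVector, rotMatrix, hH, -Complex.ofReal_mul, -Complex.ofReal_sin,
      ← hp.sin_eq]
    ring

/-- The two axes of the plane are unit vectors supported on different values of the output qubit,
hence orthonormal. -/
theorem sum_conj_planeVector_mul {b c : Fin n → ℝ} (hb : ∑ i, b i ^ 2 = 1) (hc : ∑ i, c i ^ 2 = 1)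
    (θ φ : ℝ) : ∑ x, star (planeVector b c θ x) * planeVector b c φ x = (Real.cos (θ - φ) : ℝ) := by
  have h : ∀ x, star (planeVector b c θ x) * planeVector b c φ x =
      ((if x.2 = 0 then Real.cos θ * Real.cos φ * b x.1 ^ 2
        else Real.sin θ * Real.sin φ * c x.1 ^ 2 : ℝ) : ℂ) := by
    intro x
    unfold planeVector
    split_ifs
    · rw [Complex.star_def, Complex.conj_ofReal, ← Complex.ofReal_mul]; congr 1; ring
    · rw [Complex.star_def, Complex.conj_ofReal, ← Complex.ofReal_mul]; congr 1; ring
  simp only [h]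
  rw [← Complex.ofReal_sum, Fintype.sum_prod_type]
  simp [Fin.sum_univ_two, Finset.sum_add_distrib, ← Finset.mul_sum, hb, hc, Real.cos_sub]

theorem controlledZero_superpose (F : Fin n → DTree d g A) (X : Fin d → A) {t : ℕ} (s : ℕ)
    (k : Fin t) (w : Fin n × Fin 2 → ℂ) :
    (controlledZero F t s).apply X (superpose (rootLabel F k) w) =
      superpose (rootLabel F k)
        (if s < k then (2 * w 0) • Pi.single 0 1 - w else w) := by
  rw [controlledZero, Instr.flip_superpose]
  congr 1
  funext ⟨i, o⟩
  by_cases hs : s < k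
  · by_cases h : (i, o) = 0
    · obtain ⟨rfl, rfl⟩ : i = 0 ∧ o = 0 := by simpa only [Prod.mk_eq_zero] using h
      rw [h]; simp [rootLabel, hs]; ring
    · have h' := h
      simp only [Prod.mk_eq_zero] at h'
      simp [rootLabel, hs, h, h']
  · simp [rootLabel, hs]

theorem controlledV_superpose (F : Fin n → DTree d g A) (X : Fin d → A) {t : ℕ} (s : ℕ)
    (k : Fin t) (b c : Fin n → ℝ) (φ : ℝ) :
    (controlledV F t s).apply X (superpose (leafLabel F X k) (planeVector b c φ)) =
      superpose (leafLabel F X k) (planeVector b c (if s < k then -φ else φ)) := by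
  rw [controlledV, Instr.flip_superpose]
  congr 1
  funext ⟨i, o⟩
  by_cases hs : s < k <;> fin_cases o <;> simp [leafLabel, hs, planeVector]

/-- Two reflections, `φ ↦ -φ` and `φ ↦ 2θ - φ`, compose to the rotation by `2θ`. Only the two sign
flips are controlled; when the counter does not exceed `s`, the uncontrolled `𝒰⁻¹` and `𝒰` cancel.
-/
theorem run_groverStep {F : Fin n → DTree d g A} {H : Matrix.unitaryGroup (Fin n) ℂ}
    (hH : ∀ i, (H : Matrix (Fin n) (Fin n) ℂ) i 0 = 1 / (Real.sqrt n : ℂ)) {X : Fin d → A}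
    {b c : Fin n → ℝ} {θ : ℝ} (hp : IsGroverPlane F X b c θ) {t : ℕ} (s : ℕ) (k : Fin t) (φ : ℝ) :
    (groverStep F H t s).run X (superpose (leafLabel F X k) (planeVector b c φ)) =
      superpose (leafLabel F X k) (planeVector b c (if s < k then φ + 2 * θ else φ)) := by
  have hM := forestMatrix_mem F H X
  have hU := run_forestCircuit F H X k
  simp only [groverStep, List.append_assoc, List.singleton_append, Circuit.run_cons,
    Circuit.run_append, controlledV_superpose, Circuit.run_inv_superpose X hM hU,
    controlledZero_superpose, Circuit.run_superpose_mulVec X hU]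
  congr 1
  have h1 : ∀ v, forestMatrix F H X *ᵥ (star (forestMatrix F H X) *ᵥ v) = v := fun v => by
    rw [Matrix.mulVec_mulVec, (Matrix.mem_unitaryGroup_iff).1 hM, Matrix.one_mulVec]
  split_ifs with hs
  · rw [Matrix.mulVec_sub, Matrix.mulVec_smul, h1, Matrix.mulVec_single_one]
    -- The zero amplitude after `𝒰⁻¹` is the inner product with `|Ψ⟩`, the column of the matrix at
    -- zero.
    have h2 : (star (forestMatrix F H X) *ᵥ planeVector b c (-φ)) 0 =
        (Real.cos (θ + φ) : ℝ) := by
      rw [← sub_neg_eq_add, ← sum_conj_planeVector_mul hp.sum_sq_left hp.sum_sq_right]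
      simp only [Matrix.mulVec, dotProduct, Matrix.star_apply, forestMatrix_zero hH hp]
    funext x
    simp only [Pi.sub_apply, Pi.smul_apply, Matrix.col_apply, forestMatrix_zero hH hp, smul_eq_mul,
      h2]
    have h3 : Real.cos (φ + 2 * θ) = 2 * Real.cos (θ + φ) * Real.cos θ - Real.cos (-φ) := by
      rw [show φ + 2 * θ = (θ + φ) + θ by ring, show -φ = θ - (θ + φ) by ring,
        Real.cos_add (θ + φ), Real.cos_sub θ]; ring
    have h4 : Real.sin (φ + 2 * θ) = 2 * Real.cos (θ + φ) * Real.sin θ - Real.sin (-φ) := by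
      rw [show φ + 2 * θ = (θ + φ) + θ by ring, show -φ = θ - (θ + φ) by ring,
        Real.sin_add (θ + φ), Real.sin_sub θ]; ring
    unfold planeVector
    split_ifs
    · rw [h3]; push_cast; ring
    · rw [h4]; push_cast; ring
  · exact h1 _

theorem apply_countSplit (F : Fin n → DTree d g A) (X : Fin d → A) {t : ℕ} (k : Fin t)
    (M : Matrix.unitaryGroup (Fin t) ℂ) (v : Fin n × Fin 2 → ℂ) :
    (Instr.ucg (countSplit F t) fun _ => M).apply X (superpose (leafLabel F X k) v) =
      ∑ y, (M : Matrix (Fin t) (Fin t) ℂ) y k • superpose (leafLabel F X y) v := by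
  have h : ∀ x, (Instr.ucg (countSplit F t) fun _ => M).apply X (ket (leafLabel F X k x)) =
      ∑ y, (M : Matrix (Fin t) (Fin t) ℂ) y k • ket (leafLabel F X y x) := fun x => by
    rw [Instr.ucg_ket]; rfl
  have h' := Circuit.run_superpose X [Instr.ucg (countSplit F t) fun _ => M] (leafLabel F X k) v
  simp only [Circuit.run_cons, Circuit.run_nil, h] at h'
  rw [h']
  simp only [superpose, Finset.smul_sum]
  rw [Finset.sum_comm]
  simp only [smul_comm (v _)]

theorem run_estimationCircuit {F : Fin n → DTree d g A} {H : Matrix.unitaryGroup (Fin n) ℂ}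
    (hH : ∀ i, (H : Matrix (Fin n) (Fin n) ℂ) i 0 = 1 / (Real.sqrt n : ℂ)) {X : Fin d → A}
    {b c : Fin n → ℝ} {θ : ℝ} (hp : IsGroverPlane F X b c θ) (t : ℕ) [NeZero t] :
    (estimationCircuit F H t).run X (ket (zeroLabel F t)) =
      superpose (fun x : Fin t × (Fin n × Fin 2) => leafLabel F X x.1 x.2) fun x =>
        ∑ k : Fin t, star (dftMatrix t k x.1) * dftMatrix t k 0 *
          planeVector b c ((2 * (k : ℕ) + 1) * θ) x.2 := by
  have h0 : (forestCircuit F H t).run X (ket (zeroLabel F t)) =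
      superpose (leafLabel F X 0) (planeVector b c θ) := by
    rw [← funext (forestMatrix_zero hH hp), ← run_forestCircuit]; rfl
  have h1 : Circuit.run X ((List.range (t - 1)).flatMap (groverStep F H t))
      (∑ k : Fin t, dftMatrix t k 0 • superpose (leafLabel F X k) (planeVector b c θ)) =
      ∑ k : Fin t, dftMatrix t k 0 •
        superpose (leafLabel F X k) (planeVector b c ((2 * (k : ℕ) + 1) * θ)) := by
    -- Invariant: after `s` rounds the component with counter `k` has been rotated `min k s` times.
    -- Since `k ≤ t - 1`, the `t - 1` rounds give exactly `k` rotations.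
    have h := Circuit.run_flatMap_range X (h := t - 1) (groverStep F H t) (fun s =>
      ∑ k : Fin t, dftMatrix t k 0 • superpose (leafLabel F X k)
        (planeVector b c ((2 * (min (k : ℕ) s : ℕ) + 1) * θ))) (fun s => by
        rw [Circuit.run_sum]
        refine Finset.sum_congr rfl fun k _ => ?_
        rw [Circuit.run_smul, run_groverStep hH hp]
        congr 3
        split_ifs with hs
        · rw [min_eq_right hs.le, min_eq_right (by omega)]; push_cast; ring
        · rw [min_eq_left (by omega), min_eq_left (by omega)])
    have h3 : ∀ k : Fin t, min (k : ℕ) (t - 1) = k := fun k => by have := k.2; omega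
    simpa [h3] using h
  have h2 : (estimationCircuit F H t).run X (ket (zeroLabel F t)) =
      (Instr.ucg (countSplit F t) fun _ => (dft t)⁻¹).apply X (∑ k : Fin t, dftMatrix t k 0 •
        superpose (leafLabel F X k) (planeVector b c ((2 * (k : ℕ) + 1) * θ))) := by
    rw [← h1, estimationCircuit]
    simp only [Circuit.run_append, Circuit.run_cons, Circuit.run_nil, h0, apply_countSplit]
    rfl
  have h3 := Circuit.run_sum Finset.univ X [Instr.ucg (countSplit F t) fun _ => (dft t)⁻¹]
    fun k : Fin t => dftMatrix t k 0 •
      superpose (leafLabel F X k) (planeVector b c ((2 * (k : ℕ) + 1) * θ))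
  simp only [Circuit.run_smul, Circuit.run_cons, Circuit.run_nil, apply_countSplit] at h3
  rw [h2, h3]
  simp only [superpose, Fintype.sum_prod_type, Finset.smul_sum, Finset.sum_smul]
  rw [Finset.sum_comm]
  refine Finset.sum_congr rfl fun y _ => ?_
  rw [Finset.sum_comm]
  refine Finset.sum_congr rfl fun i _ => ?_
  rw [Finset.sum_comm]
  refine Finset.sum_congr rfl fun o _ => Finset.sum_congr rfl fun k _ => ?_
  rw [smul_smul, smul_smul, mul_comm (dftMatrix t k 0)]
  rfl

theorem queries_estimationCircuit_le (F : Fin n → DTree d g A) (H : Matrix.unitaryGroup (Fin n) ℂ)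
    (t : ℕ) [NeZero t] : (estimationCircuit F H t).queries ≤ 4 * t * forestHeight F := by
  -- A Grover step uses `𝒰⁻¹` and `𝒰`, each with `2h` queries; with the first preparation this makes
  -- `2h + 4h(t - 1)` in total.
  have h : ∀ s, (groverStep F H t s).queries = 4 * forestHeight F := fun s => by
    simp only [groverStep, Circuit.queries_append, Circuit.queries_inv, queries_forestCircuit]
    simp only [Circuit.queries, controlledV, controlledZero, Instr.queries, List.map_cons,
      List.map_nil, List.sum_cons, List.sum_nil]
    ring
  have ht : 0 < t := NeZero.pos t
  simp only [estimationCircuit, Circuit.queries_append, queries_forestCircuit,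
    Circuit.queries_flatMap _ _ _ h]
  obtain ⟨u, rfl⟩ : ∃ u, t = u + 1 := ⟨t - 1, by omega⟩
  simp only [Circuit.queries, Instr.queries, List.map_cons, List.map_nil, List.sum_cons,
    List.sum_nil, List.length_range, Nat.add_sub_cancel]
  ring_nf
  omega

end Estimation

/-! ## The Fejér kernel -/

section Fejer

/-- The Fejér kernel of order `t`, normalized to the value `1` at `0`, with period `π`. -/
noncomputable def fejer (t : ℕ) (u : ℝ) : ℝ :=
  (‖∑ k ∈ Finset.range t, Complex.exp (Complex.I * (2 * u : ℝ)) ^ k‖ / t) ^ 2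

theorem fejer_nonneg (t : ℕ) (u : ℝ) : 0 ≤ fejer t u := sq_nonneg _

theorem fejer_add_int_mul_pi (t : ℕ) (u : ℝ) (m : ℤ) : fejer t (u + m * Real.pi) = fejer t u := by
  have h : Complex.exp (Complex.I * (2 * (u + m * Real.pi) : ℝ)) =
      Complex.exp (Complex.I * (2 * u : ℝ)) := by
    rw [Complex.exp_eq_exp_iff_exists_int]
    exact ⟨m, by push_cast; ring⟩
  rw [fejer, h, fejer]

theorem fejer_zero {t : ℕ} (ht : 0 < t) : fejer t 0 = 1 := by
  have : (t : ℝ) ≠ 0 := by positivity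
  simp [fejer, this]

theorem fejer_one (u : ℝ) : fejer 1 u = 1 := by simp [fejer]

/-- The geometric sum satisfies `|sin u| · |∑ z^k| = |sin (t u)|` with `u = π x / t`, and `|sin u| ≤
|u|`. The product form avoids dividing by `sin u`, which may vanish. -/
theorem sinc_sq_le_fejer {t : ℕ} (ht : 0 < t) {x : ℝ} (hx : x ≠ 0) :
    (Real.sin (Real.pi * x) / (Real.pi * x)) ^ 2 ≤ fejer t (Real.pi * x / t) := by
  have ht' : (0 : ℝ) < t := by exact_mod_cast ht
  have htc : (t : ℂ) ≠ 0 := by exact_mod_cast ht.ne'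
  set u : ℝ := Real.pi * x / t with hu
  set z := Complex.exp (Complex.I * (2 * u : ℝ)) with hz
  have h1 := congrArg norm (mul_neg_geom_sum z t)
  rw [norm_mul, norm_sub_rev, norm_sub_rev 1, hz, ← Complex.exp_nat_mul,
    show (t : ℂ) * (Complex.I * (2 * u : ℝ)) = Complex.I * (2 * (Real.pi * x) : ℝ) by
      rw [hu]; push_cast; field_simp,
    Complex.norm_exp_I_mul_ofReal_sub_one, Complex.norm_exp_I_mul_ofReal_sub_one, ← hz] at h1
  simp only [norm_mul, Real.norm_eq_abs, mul_div_cancel_left₀ _ (two_ne_zero' ℝ), abs_two] at h1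
  have h2 : |Real.sin u| ≤ |u| := Real.abs_sin_le_abs
  have h3 : |Real.sin (Real.pi * x)| ≤ |u| * ‖∑ k ∈ Finset.range t, z ^ k‖ := by
    have := mul_le_mul_of_nonneg_right h2 (norm_nonneg (∑ k ∈ Finset.range t, z ^ k))
    linarith
  have hx' : 0 < |x| := abs_pos.2 hx
  rw [fejer, ← sq_abs]
  refine pow_le_pow_left₀ (abs_nonneg _) ?_ 2
  rw [abs_div, div_le_div_iff₀ (abs_pos.2 (by positivity)) ht']
  calc |Real.sin (Real.pi * x)| * t ≤ |u| * ‖∑ k ∈ Finset.range t, z ^ k‖ * t := by gcongr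
    _ = ‖∑ k ∈ Finset.range t, z ^ k‖ * |Real.pi * x| := by
      rw [hu, abs_div, abs_of_pos ht']; field_simp

theorem sinc_sq_ge_of_abs_le {x : ℝ} (hx : x ≠ 0) (hx' : |x| ≤ 1 / 4) :
    79 / 100 ≤ (Real.sin (Real.pi * x) / (Real.pi * x)) ^ 2 := by
  wlog h : 0 < x generalizing x
  · have := this (neg_ne_zero.2 hx) (by rwa [abs_neg]) (by
      rcases lt_or_gt_of_ne hx with h' | h'
      · linarith
      · exact absurd h' h)
    simpa [Real.sin_neg, neg_div_neg_eq] using this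
  rw [abs_of_pos h] at hx'
  have hpi := Real.pi_pos
  have hpi' := Real.pi_lt_d2
  have h1 : 0 < Real.pi * x := by positivity
  -- `63/80` is `3.15 / 4`, from `π < 3.15` and `x ≤ 1/4`.
  have h2 : Real.pi * x ≤ 63 / 80 := by nlinarith
  have h3 : 1 - (63 / 80) ^ 2 / 6 ≤ Real.sin (Real.pi * x) / (Real.pi * x) := by
    rw [le_div_iff₀ h1]
    have := Real.sin_ge_sub_cube h1.le
    nlinarith [mul_nonneg h1.le (mul_nonneg (sub_nonneg.2 h2) (by positivity : 0 ≤ 63 / 80 + Real.pi * x))]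
  calc (79 / 100 : ℝ) ≤ (1 - (63 / 80) ^ 2 / 6) ^ 2 := by norm_num
    _ ≤ _ := pow_le_pow_left₀ (by norm_num) h3 2

/-- Near either end one term suffices. In the middle, with `x = s + 1/2`, both sines are `± cos (π
s)` and the sum is at least `8/π²`, its value at the midpoint; `π² ≤ 10` then leaves `8/10`. -/
theorem sinc_sq_add_sinc_sq_ge {x : ℝ} (h0 : 0 < x) (h1 : x < 1) :
    79 / 100 ≤ (Real.sin (Real.pi * x) / (Real.pi * x)) ^ 2 +
      (Real.sin (Real.pi * (x - 1)) / (Real.pi * (x - 1))) ^ 2 := by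
  rcases le_total x (1 / 4) with h | h
  · have := sinc_sq_ge_of_abs_le h0.ne' (by rwa [abs_of_pos h0])
    have := sq_nonneg (Real.sin (Real.pi * (x - 1)) / (Real.pi * (x - 1)))
    linarith
  rcases le_total (3 / 4) x with h' | h'
  · have := sinc_sq_ge_of_abs_le (sub_neg.2 h1).ne (by rw [abs_of_neg (sub_neg.2 h1)]; linarith)
    have := sq_nonneg (Real.sin (Real.pi * x) / (Real.pi * x))
    linarith
  have hpi := Real.pi_pos
  have hpi2 : Real.pi ^ 2 ≤ 10 := by nlinarith [Real.pi_lt_d2]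
  obtain ⟨s, rfl⟩ : ∃ s, x = s + 1 / 2 := ⟨x - 1 / 2, by ring⟩
  have e1 : Real.sin (Real.pi * (s + 1 / 2)) = Real.cos (Real.pi * s) := by
    rw [show Real.pi * (s + 1 / 2) = Real.pi * s + Real.pi / 2 by ring, Real.sin_add_pi_div_two]
  have e2 : Real.sin (Real.pi * (s + 1 / 2 - 1)) = -Real.cos (Real.pi * s) := by
    rw [show Real.pi * (s + 1 / 2 - 1) = Real.pi * s - Real.pi / 2 by ring,
      Real.sin_sub_pi_div_two]
  have hv : s ^ 2 ≤ 1 / 16 := by nlinarith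
  have hc : 1 - 5 * s ^ 2 ≤ Real.cos (Real.pi * s) := by
    have := Real.one_sub_sq_div_two_le_cos (x := Real.pi * s)
    nlinarith [sq_nonneg s]
  have hc2 : (1 - 5 * s ^ 2) ^ 2 ≤ Real.cos (Real.pi * s) ^ 2 :=
    pow_le_pow_left₀ (by linarith) hc 2
  -- This is the bound `8/π²` with denominators cleared, with equality at `s = 0`. After replacing
  -- the cosine by `1 - 5 s²`, the difference of the two sides is half the polynomial in `h6`.
  have hq : 8 * (1 / 4 - s ^ 2) ^ 2 ≤ Real.cos (Real.pi * s) ^ 2 * (1 / 2 + 2 * s ^ 2) := by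
    have h5 : 8 * (1 / 4 - s ^ 2) ^ 2 ≤ (1 - 5 * s ^ 2) ^ 2 * (1 / 2 + 2 * s ^ 2) := by
      have h6 : 0 ≤ s ^ 2 * (2 - 31 * s ^ 2 + 100 * (s ^ 2) ^ 2) :=
        mul_nonneg (sq_nonneg _) (by nlinarith [sq_nonneg (s ^ 2)])
      nlinarith
    exact h5.trans (mul_le_mul_of_nonneg_right hc2 (by positivity))
  rw [e1, e2]
  have hs1 : s + 1 / 2 ≠ 0 := by linarith
  have hs2 : s + 1 / 2 - 1 ≠ 0 := by linarith
  have hd : 0 < 1 / 4 - s ^ 2 := by linarith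
  have e3 : (Real.cos (Real.pi * s) / (Real.pi * (s + 1 / 2))) ^ 2 +
      (-Real.cos (Real.pi * s) / (Real.pi * (s + 1 / 2 - 1))) ^ 2 =
      Real.cos (Real.pi * s) ^ 2 * (1 / 2 + 2 * s ^ 2) / (Real.pi ^ 2 * (1 / 4 - s ^ 2) ^ 2) := by
    rw [show (1 / 4 - s ^ 2) ^ 2 = (s + 1 / 2) ^ 2 * (s + 1 / 2 - 1) ^ 2 by ring]
    rw [div_pow, div_pow, neg_sq, mul_pow, mul_pow, div_add_div _ _ (by positivity) (by positivity),
      div_eq_div_iff (by positivity) (by positivity)]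
    ring
  rw [e3, le_div_iff₀ (by positivity)]
  nlinarith [mul_le_mul_of_nonneg_right hpi2 (sq_nonneg (1 / 4 - s ^ 2))]

/-- The two points of the grid `π y / t` next to `θ` (modulo `π`) carry most of the weight. -/
theorem sum_fejer_ge {t : ℕ} (ht : 0 < t) (θ : ℝ) (S : Finset (Fin t))
    (hS : ∀ (y : Fin t) (m : ℤ), |θ - Real.pi * (y : ℕ) / t + m * Real.pi| ≤ Real.pi / t → y ∈ S) :
    79 / 100 ≤ ∑ y ∈ S, fejer t (θ - Real.pi * (y : ℕ) / t) := by
  have ht' : (0 : ℝ) < t := by exact_mod_cast ht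
  have hpi := Real.pi_pos
  -- Any integer grid index is reduced modulo `t` to a counter value; the discarded multiple of `t`
  -- shifts the angle by a multiple of the period `π`.
  have grid : ∀ f : ℤ, ∃ (y : Fin t) (m : ℤ), (f : ℝ) = y + m * t := fun f => by
    have hn : 0 ≤ f % t := Int.emod_nonneg _ (by omega)
    have hlt : f % t < t := Int.emod_lt_of_pos _ (by omega)
    refine ⟨⟨(f % t).toNat, by omega⟩, f / t, ?_⟩
    have h := Int.emod_add_mul_ediv f t
    have h' : (((f % t).toNat : ℤ) : ℝ) = ((f % t : ℤ) : ℝ) := by rw [Int.toNat_of_nonneg hn]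
    rw [Int.cast_natCast] at h'
    simp only [h']
    rw [mul_comm] at h
    exact_mod_cast h.symm
  have key : ∀ (f : ℤ) (y : Fin t) (m : ℤ), (f : ℝ) = y + m * t →
      θ - Real.pi * (y : ℕ) / t = Real.pi * (t * θ / Real.pi - f) / t + m * Real.pi := by
    intro f y m h
    rw [h]; field_simp; ring
  have mem : ∀ (f : ℤ) (y : Fin t) (m : ℤ), (f : ℝ) = y + m * t →
      |t * θ / Real.pi - f| ≤ 1 → y ∈ S := by
    intro f y m h hf
    refine hS y (-m) ?_
    rw [key f y m h, Int.cast_neg, neg_mul, add_neg_cancel_right, abs_div, abs_mul,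
      abs_of_pos ht', abs_of_pos hpi]
    gcongr
    exact mul_le_of_le_one_right hpi.le hf
  set x := t * θ / Real.pi with hx
  have hfl := Int.floor_le x
  have hfl' := Int.lt_floor_add_one x
  obtain ⟨y₁, m₁, h₁⟩ := grid ⌊x⌋
  have hm₁ : y₁ ∈ S := mem _ _ _ h₁ (by rw [abs_le]; constructor <;> linarith)
  have single : ∀ y ∈ S, fejer t (θ - Real.pi * (y : ℕ) / t) ≤
      ∑ y ∈ S, fejer t (θ - Real.pi * (y : ℕ) / t) := fun y hy =>
    Finset.single_le_sum (f := fun y : Fin t => fejer t (θ - Real.pi * (y : ℕ) / t))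
      (fun _ _ => fejer_nonneg _ _) hy
  rcases hfl.eq_or_lt with h0 | h0
  · refine le_trans ?_ (single _ hm₁)
    rw [key _ _ _ h₁, fejer_add_int_mul_pi, ← h0]
    simp [fejer_zero ht]; norm_num
  -- For `t = 1` the two neighbouring grid points are the same counter value, so they cannot be
  -- counted separately; the kernel is then constantly `1`.
  · by_cases ht1 : t = 1
    · refine le_trans ?_ (single _ hm₁)
      subst ht1; rw [fejer_one]; norm_num
    obtain ⟨y₂, m₂, h₂⟩ := grid (⌊x⌋ + 1)
    have hm₂ : y₂ ∈ S := mem _ _ _ h₂ (by push_cast; rw [abs_le]; constructor <;> linarith)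
    have hne : y₁ ≠ y₂ := by
      rintro rfl
      have h3 : (1 : ℝ) = (m₂ - m₁) * t := by push_cast at h₂; linarith
      have h4 : (1 : ℤ) = (m₂ - m₁) * t := by exact_mod_cast h3
      have h5 : (t : ℤ) ∣ 1 := ⟨_, h4.trans (mul_comm _ _)⟩
      exact ht1 (by exact_mod_cast Int.eq_one_of_dvd_one (by omega) h5)
    have h6 := sinc_sq_add_sinc_sq_ge (x := x - ⌊x⌋) (by linarith) (by linarith)
    have h7 := sinc_sq_le_fejer ht (x := x - ⌊x⌋) (by linarith)
    have h8 := sinc_sq_le_fejer ht (x := x - ⌊x⌋ - 1) (by linarith)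
    rw [← fejer_add_int_mul_pi _ _ m₁, ← key _ _ _ h₁] at h7
    rw [show x - ⌊x⌋ - 1 = x - (⌊x⌋ + 1 : ℤ) by push_cast; ring,
      ← fejer_add_int_mul_pi _ _ m₂, ← key _ _ _ h₂] at h8
    calc (79 / 100 : ℝ) ≤ _ := h6
      _ ≤ fejer t (θ - Real.pi * (y₁ : ℕ) / t) + fejer t (θ - Real.pi * (y₂ : ℕ) / t) := by
        refine add_le_add h7 (le_trans (le_of_eq ?_) h8)
        push_cast; ring_nf
      _ = ∑ y ∈ {y₁, y₂}, fejer t (θ - Real.pi * (y : ℕ) / t) := 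
        (Finset.sum_pair (f := fun y : Fin t => fejer t (θ - Real.pi * (y : ℕ) / t)) hne).symm
      _ ≤ _ := Finset.sum_le_sum_of_subset_of_nonneg (by
        intro y hy; rcases Finset.mem_insert.1 hy with rfl | hy
        · exact hm₁
        · rwa [Finset.mem_singleton.1 hy]) fun _ _ _ => fejer_nonneg _ _

/-- With `φ = θ + η` the difference is `sin η · sin (2θ + η)`; the second factor is expanded by the
addition theorem. -/
theorem abs_sin_sq_sub_sin_sq_le {φ θ ε : ℝ} (h : |φ - θ| ≤ ε) :
    |Real.sin φ ^ 2 - Real.sin θ ^ 2| ≤ |Real.sin (2 * θ)| * ε + ε ^ 2 := by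
  obtain ⟨η, rfl⟩ : ∃ η, φ = θ + η := ⟨φ - θ, by ring⟩
  rw [add_sub_cancel_left] at h
  have h1 : Real.sin (θ + η) ^ 2 - Real.sin θ ^ 2 =
      Real.sin η * (Real.sin (2 * θ) * Real.cos η + Real.cos (2 * θ) * Real.sin η) := by
    have e1 := Real.sin_sq_add_cos_sq θ
    have e2 := Real.sin_sq_add_cos_sq η
    rw [Real.sin_add, Real.sin_two_mul, Real.cos_two_mul]
    linear_combination (Real.sin θ ^ 2) * e2 - (Real.sin η ^ 2) * e1
  have h2 : |Real.sin η| ≤ ε := Real.abs_sin_le_abs.trans h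
  have h3 : |Real.sin (2 * θ) * Real.cos η + Real.cos (2 * θ) * Real.sin η| ≤
      |Real.sin (2 * θ)| + ε := by
    refine (abs_add_le _ _).trans (add_le_add ?_ ?_)
    · rw [abs_mul]; exact mul_le_of_le_one_right (abs_nonneg _) (Real.abs_cos_le_one _)
    · rw [abs_mul]
      exact (mul_le_of_le_one_left (abs_nonneg _) (Real.abs_cos_le_one _)).trans h2
  rw [h1, abs_mul]
  calc _ ≤ ε * (|Real.sin (2 * θ)| + ε) :=
        mul_le_mul h2 h3 (abs_nonneg _) ((abs_nonneg _).trans h2)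
    _ = _ := by ring

end Fejer

/-! ## The law of the measured counter value -/

section CounterLaw

/-- Up to the global phase `e^{iφ}` the terms form a geometric series with ratio `e^{2i(φ - π y /
t)}`. -/
theorem norm_sum_dft_mul_exp (t : ℕ) [NeZero t] (y : Fin t) (φ : ℝ) :
    ‖∑ k : Fin t, star (dftMatrix t k y) * dftMatrix t k 0 *
      Complex.exp (((2 * (k : ℕ) + 1) * φ : ℝ) * Complex.I)‖ ^ 2 =
      fejer t (φ - Real.pi * (y : ℕ) / t) := by
  have ht : (t : ℂ) ≠ 0 := by exact_mod_cast NeZero.ne t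
  have hs : (1 / (Real.sqrt t : ℂ)) * (1 / (Real.sqrt t : ℂ)) = 1 / t := by
    rw [div_mul_div_comm, ← Complex.ofReal_mul, Real.mul_self_sqrt (by positivity)]; simp
  have h : ∀ k : Fin t, star (dftMatrix t k y) * dftMatrix t k 0 *
      Complex.exp (((2 * (k : ℕ) + 1) * φ : ℝ) * Complex.I) =
      (1 / t : ℂ) * Complex.exp (φ * Complex.I) *
        Complex.exp (Complex.I * (2 * (φ - Real.pi * (y : ℕ) / t) : ℝ)) ^ (k : ℕ) := by
    intro k
    have hc : (starRingEnd ℂ) (2 * Real.pi * Complex.I * (k : ℕ) * (y : ℕ) / (t : ℂ)) =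
        -(2 * Real.pi * Complex.I * (k : ℕ) * (y : ℕ) / (t : ℂ)) := by
      simp only [map_div₀, map_mul, map_ofNat, Complex.conj_ofReal, Complex.conj_I, map_natCast]
      ring
    have h1 : star (dftMatrix t k y) = (1 / (Real.sqrt t : ℂ)) *
        Complex.exp (-(2 * Real.pi * Complex.I * (k : ℕ) * (y : ℕ) / (t : ℂ))) := by
      rw [dftMatrix, Matrix.of_apply, star_mul', Complex.star_def,
        ← Complex.exp_conj, hc, map_div₀, map_one, Complex.conj_ofReal]
    have h2 : dftMatrix t k 0 = 1 / (Real.sqrt t : ℂ) := by simp [dftMatrix]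
    rw [h1, h2, mul_right_comm (1 / (Real.sqrt t : ℂ)), hs, mul_assoc (1 / (t : ℂ)),
      mul_assoc (1 / (t : ℂ)), ← Complex.exp_add,
      ← Complex.exp_nat_mul, ← Complex.exp_add]
    congr 2
    push_cast
    ring
  have h' : ‖Complex.exp (φ * Complex.I)‖ = 1 := Complex.norm_exp_ofReal_mul_I φ
  rw [Finset.sum_congr rfl fun k _ => h k, ← Finset.mul_sum, Fin.sum_univ_eq_sum_range fun k =>
    Complex.exp (Complex.I * (2 * (φ - Real.pi * (y : ℕ) / t) : ℝ)) ^ k, norm_mul, norm_mul, h',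
    fejer]
  congr 1
  rw [norm_div, norm_one, Complex.norm_natCast]
  ring

/-- The weight is `|p|² + |q|²` for the cosine sum `p` and the sine sum `q`, and the parallelogram
law makes it the mean of `|p + i q|²` and `|p - i q|²`. This replaces the passage to eigenvectors of
the Grover rotation. -/
theorem sum_norm_sq_planeVector {n : ℕ} {b c : Fin n → ℝ} (hb : ∑ i, b i ^ 2 = 1)
    (hc : ∑ i, c i ^ 2 = 1) {ι : Type} [Fintype ι] (a : ι → ℂ) (φ : ι → ℝ) :
    ∑ x, ‖∑ k, a k * planeVector b c (φ k) x‖ ^ 2 =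
      (‖∑ k, a k * Complex.exp ((φ k : ℝ) * Complex.I)‖ ^ 2 +
        ‖∑ k, a k * Complex.exp ((-φ k : ℝ) * Complex.I)‖ ^ 2) / 2 := by
  set p : ℂ := ∑ k, a k * (Real.cos (φ k) : ℂ) with hp
  set q : ℂ := ∑ k, a k * (Real.sin (φ k) : ℂ) with hq
  have h1 : ∑ k, a k * Complex.exp ((φ k : ℝ) * Complex.I) = p + Complex.I * q := by
    rw [hp, hq, Finset.mul_sum, ← Finset.sum_add_distrib]
    refine Finset.sum_congr rfl fun k _ => ?_
    rw [Complex.exp_mul_I, Complex.ofReal_cos, Complex.ofReal_sin]; ring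
  have h2 : ∑ k, a k * Complex.exp ((-φ k : ℝ) * Complex.I) = p - Complex.I * q := by
    rw [hp, hq, Finset.mul_sum, ← Finset.sum_sub_distrib]
    refine Finset.sum_congr rfl fun k _ => ?_
    rw [Complex.exp_mul_I, Complex.ofReal_neg, Complex.cos_neg, Complex.sin_neg,
      Complex.ofReal_cos, Complex.ofReal_sin]; ring
  have h3 : ∀ i, ‖∑ k, a k * planeVector b c (φ k) (i, 0)‖ ^ 2 = ‖p‖ ^ 2 * b i ^ 2 := fun i => by
    rw [← sq_abs (b i), ← Real.norm_eq_abs, ← Complex.norm_real, ← mul_pow, ← norm_mul, hp,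
      Finset.sum_mul]
    simp [planeVector, mul_assoc]
  have h4 : ∀ i, ‖∑ k, a k * planeVector b c (φ k) (i, 1)‖ ^ 2 = ‖q‖ ^ 2 * c i ^ 2 := fun i => by
    rw [← sq_abs (c i), ← Real.norm_eq_abs, ← Complex.norm_real, ← mul_pow, ← norm_mul, hq,
      Finset.sum_mul]
    simp [planeVector, mul_assoc]
  have h5 := parallelogram_law_with_norm ℂ p (Complex.I * q)
  rw [norm_mul, Complex.norm_I, one_mul] at h5
  rw [h1, h2, Fintype.sum_prod_type]
  simp only [Fin.sum_univ_two, h3, h4, Finset.sum_add_distrib, ← Finset.mul_sum, hb, hc]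
  linarith

variable {d g n : ℕ} {A : Type} [NeZero d] [NeZero g] [NeZero n] [AddCommGroup A]

theorem counterLaw_apply {F : Fin n → DTree d g A} {H : Matrix.unitaryGroup (Fin n) ℂ}
    (hH : ∀ i, (H : Matrix (Fin n) (Fin n) ℂ) i 0 = 1 / (Real.sqrt n : ℂ)) {X : Fin d → A}
    {b c : Fin n → ℝ} {θ : ℝ} (hp : IsGroverPlane F X b c θ) (t : ℕ) [NeZero t] (y : Fin t) :
    counterLaw F H t X y = ENNReal.ofReal ((fejer t (θ - Real.pi * (y : ℕ) / t) +
      fejer t (-θ - Real.pi * (y : ℕ) / t)) / 2) := by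
  classical
  set l := fun x : Fin t × (Fin n × Fin 2) => leafLabel F X x.1 x.2 with hl
  have hinj : Function.Injective l := leafLabel_injective F X
  set w := fun x : Fin t × (Fin n × Fin 2) => ∑ k : Fin t, star (dftMatrix t k x.1) *
    dftMatrix t k 0 * planeVector b c ((2 * (k : ℕ) + 1) * θ) x.2 with hw
  have hm : ∀ b', (estimationCircuit F H t).measure X (zeroLabel F t) b' =
      ‖superpose l w b'‖ₑ ^ 2 := fun b' => by
    rw [← run_estimationCircuit hH hp t]; rfl
  -- Only leaf labels carry amplitude, so the sum over the possibly infinite basis becomes finite.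
  have hsupp : Function.support (fun b' : ForestBasis F t => if y = b'.2.2.count then
      ‖superpose l w b'‖ₑ ^ 2 else 0) ⊆ Set.range l := by
    intro b' hb'
    by_contra h
    exact hb' (by simp [superpose_apply_of_notMem w h])
  rw [counterLaw, PMF.map_apply]
  simp only [hm]
  have hcount : ∀ x, (l x).2.2.count = x.1 := fun x => rfl
  have hsum : ∑' b' : ForestBasis F t, (if y = b'.2.2.count then ‖superpose l w b'‖ₑ ^ 2 else 0) =
      ∑ x, ‖w (y, x)‖ₑ ^ 2 := by
    rw [← hinj.tsum_eq hsupp, tsum_fintype, Fintype.sum_prod_type]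
    simp only [superpose_apply_label hinj, hcount]
    rw [Finset.sum_eq_single y] <;> simp +contextual [eq_comm]
  have hreal : ∑ x, ‖w (y, x)‖ₑ ^ 2 = ENNReal.ofReal (∑ x, ‖w (y, x)‖ ^ 2) := by
    rw [ENNReal.ofReal_sum_of_nonneg fun _ _ => by positivity]
    refine Finset.sum_congr rfl fun x _ => ?_
    rw [ENNReal.ofReal_pow (norm_nonneg _), ofReal_norm]
  refine Eq.trans ?_ (hsum.trans (hreal.trans ?_))
  · refine tsum_congr fun b' => ?_
    congr
  congr 1
  have hneg : ∀ k : Fin t, -((2 * (k : ℕ) + 1) * θ) = (2 * ((k : ℕ) : ℝ) + 1) * -θ := fun k => by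
    ring
  rw [← norm_sum_dft_mul_exp, ← norm_sum_dft_mul_exp]
  simp only [hw]
  rw [sum_norm_sq_planeVector hp.sum_sq_left hp.sum_sq_right]
  simp only [hneg]

theorem counterLaw_good_ge {F : Fin n → DTree d g A} {H : Matrix.unitaryGroup (Fin n) ℂ}
    (hH : ∀ i, (H : Matrix (Fin n) (Fin n) ℂ) i 0 = 1 / (Real.sqrt n : ℂ)) {X : Fin d → A}
    {b c : Fin n → ℝ} {θ : ℝ} (hp : IsGroverPlane F X b c θ) (t : ℕ) [NeZero t] :
    ENNReal.ofReal (79 / 100) ≤ (counterLaw F H t X).toMeasure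
      {y | |Real.sin (Real.pi * ((y : ℕ) : ℝ) / t) ^ 2 - Real.sin θ ^ 2| ≤
        |Real.sin (2 * θ)| * (Real.pi / t) + (Real.pi / t) ^ 2} := by
  classical
  set S : Finset (Fin t) := {y | |Real.sin (Real.pi * ((y : ℕ) : ℝ) / t) ^ 2 - Real.sin θ ^ 2| ≤
    |Real.sin (2 * θ)| * (Real.pi / t) + (Real.pi / t) ^ 2} with hS
  have hset : {y : Fin t | |Real.sin (Real.pi * ((y : ℕ) : ℝ) / t) ^ 2 - Real.sin θ ^ 2| ≤
      |Real.sin (2 * θ)| * (Real.pi / t) + (Real.pi / t) ^ 2} = ↑S := by simp [hS]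
  have hsin : ∀ (x : ℝ) (m : ℤ), Real.sin (x - m * Real.pi) ^ 2 = Real.sin x ^ 2 := fun x m => by
    rw [Real.sin_sub_int_mul_pi, mul_pow, ← sq_abs ((-1 : ℝ) ^ m), abs_zpow]; simp
  have near : ∀ (θ' : ℝ) (y : Fin t) (m : ℤ),
      |θ' - Real.pi * (y : ℕ) / t + m * Real.pi| ≤ Real.pi / t →
      |Real.sin (Real.pi * ((y : ℕ) : ℝ) / t) ^ 2 - Real.sin θ' ^ 2| ≤
        |Real.sin (2 * θ')| * (Real.pi / t) + (Real.pi / t) ^ 2 := by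
    intro θ' y m h
    rw [← hsin (Real.pi * ((y : ℕ) : ℝ) / t) m]
    refine abs_sin_sq_sub_sin_sq_le ?_
    rw [abs_sub_comm]
    convert h using 2
    ring
  have ht : 0 < t := NeZero.pos t
  -- The condition defining `S` is unchanged under `θ ↦ -θ`, so one set serves both kernels and
  -- their mean.
  have h1 := sum_fejer_ge ht θ S fun y m h => by simpa [hS] using near θ y m h
  have h2 := sum_fejer_ge ht (-θ) S fun y m h => by
    simpa [hS, Real.sin_neg, mul_neg] using near (-θ) y m h
  rw [hset, PMF.toMeasure_apply_finset]
  simp only [counterLaw_apply hH hp]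
  rw [← ENNReal.ofReal_sum_of_nonneg fun y _ =>
    div_nonneg (add_nonneg (fejer_nonneg _ _) (fejer_nonneg _ _)) zero_le_two]
  refine ENNReal.ofReal_le_ofReal ?_
  rw [← Finset.sum_div, Finset.sum_add_distrib]
  linarith

end CounterLaw

/-! ## The median of independent estimates -/

section Median

/-- After sorting, `r` entries precede the median and `r` entries start with it. A median that is
too small makes the first group bad, one that is too large the second. -/
theorem exists_card_eq_of_median_notMem {r : ℕ} (hr : 0 < r) (v : Fin (2 * r) → ℝ) {lo hi : ℝ}
    (hv : median v ∉ Set.Icc lo hi) :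
    ∃ s : Finset (Fin (2 * r)), s.card = r ∧ ∀ k ∈ s, v k ∉ Set.Icc lo hi := by
  have hm : 2 * r / 2 = r := by omega
  set j : Fin (2 * r) := ⟨2 * r / 2, by omega⟩ with hj
  have hmed : median v = v (Tuple.sort v j) := by rw [median, dif_pos (by omega)]
  have hmono := Tuple.monotone_sort v
  rw [hmed, Set.mem_Icc, not_and_or, not_le, not_le] at hv
  rcases hv with hv | hv
  · refine ⟨(Finset.Iio j).map (Tuple.sort v).toEmbedding, by simp [hj], fun k hk => ?_⟩
    obtain ⟨i, hi, rfl⟩ := Finset.mem_map.1 hk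
    exact fun h => absurd (h.1.trans (hmono (Finset.mem_Iio.1 hi).le)) (not_le.2 hv)
  · refine ⟨(Finset.Ici j).map (Tuple.sort v).toEmbedding, by simp [hj]; omega, fun k hk => ?_⟩
    obtain ⟨i, hi, rfl⟩ := Finset.mem_map.1 hk
    exact fun h => absurd ((hmono (Finset.mem_Ici.1 hi)).trans h.2) (not_le.2 hv)

/-- The median of `2 r` independent estimates is in the interval unless `r` of them are not. -/
theorem pi_real_median_mem_ge {α : Type} [Fintype α] [MeasurableSpace α]
    [MeasurableSingletonClass α] (μ : Measure α) [IsProbabilityMeasure μ] (f : α → ℝ) {lo hi : ℝ}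
    (hμ : ENNReal.ofReal (79 / 100) ≤ μ {a | f a ∈ Set.Icc lo hi}) {r : ℕ} (hr : 0 < r) :
    1 - (84 / 100 : ℝ) ^ r ≤ (Measure.pi fun _ : Fin (2 * r) => μ).real
      {v | median (fun k => f (v k)) ∈ Set.Icc lo hi} := by
  classical
  set G : Set α := {a | f a ∈ Set.Icc lo hi} with hG
  set P := Measure.pi fun _ : Fin (2 * r) => μ with hP
  have hGc : μ.real Gᶜ ≤ 21 / 100 := by
    have h1 : 79 / 100 ≤ μ.real G := (ENNReal.ofReal_le_iff_le_toReal (measure_ne_top _ _)).1 hμ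
    rw [probReal_compl_eq_one_sub (Set.toFinite G).measurableSet]
    linarith
  have hbox : ∀ s : Finset (Fin (2 * r)), P.real (Set.univ.pi fun k =>
      if k ∈ s then Gᶜ else Set.univ) = μ.real Gᶜ ^ s.card := by
    intro s
    rw [Measure.real, hP, Measure.pi_pi, ENNReal.toReal_prod, ← Finset.prod_const,
      ← Finset.prod_filter_mul_prod_filter_not Finset.univ (· ∈ s), Finset.prod_filter]
    rw [Finset.prod_eq_one (s := Finset.univ.filter fun k => k ∉ s) fun k hk => by
      simp [(Finset.mem_filter.1 hk).2], mul_one, ← Finset.prod_filter]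
    rw [Finset.filter_mem_eq_inter, Finset.univ_inter]
    exact Finset.prod_congr rfl fun k hk => by simp [hk, Measure.real]
  set E : Set (Fin (2 * r) → α) := {v | median (fun k => f (v k)) ∈ Set.Icc lo hi} with hE
  have hsub : Eᶜ ⊆ ⋃ s ∈ Finset.powersetCard r (Finset.univ : Finset (Fin (2 * r))),
      Set.univ.pi fun k => if k ∈ s then Gᶜ else Set.univ := by
    intro v hv
    obtain ⟨s, hs, h⟩ := exists_card_eq_of_median_notMem hr (fun k => f (v k)) hv
    simp only [Set.mem_iUnion]
    refine ⟨s, Finset.mem_powersetCard.2 ⟨Finset.subset_univ _, hs⟩, fun k _ => ?_⟩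
    dsimp only
    split_ifs with hk
    · exact h k hk
    · trivial
  -- Union bound over the sets of `r` failing runs: there are at most `4^r` of them, and `4 · 21/100
  -- = 84/100`.
  have hle : P.real Eᶜ ≤ (84 / 100 : ℝ) ^ r :=
    calc P.real Eᶜ ≤ _ := measureReal_mono hsub (measure_ne_top _ _)
      _ ≤ ∑ s ∈ Finset.powersetCard r (Finset.univ : Finset (Fin (2 * r))), P.real
          (Set.univ.pi fun k => if k ∈ s then Gᶜ else Set.univ) :=
        measureReal_biUnion_finset_le _ _
      _ = ((2 * r).choose r : ℝ) * μ.real Gᶜ ^ r := by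
        rw [Finset.sum_congr rfl fun s hs => by rw [hbox, (Finset.mem_powersetCard.1 hs).2],
          Finset.sum_const, Finset.card_powersetCard, Finset.card_univ, Fintype.card_fin,
          nsmul_eq_mul]
      _ ≤ (2 : ℝ) ^ (2 * r) * (21 / 100) ^ r := by
        gcongr
        exact_mod_cast Nat.choose_le_two_pow (2 * r) r
      _ = (84 / 100 : ℝ) ^ r := by rw [pow_mul, ← mul_pow]; norm_num
  have hEm : MeasurableSet E := (Set.toFinite E).measurableSet
  rw [probReal_compl_eq_one_sub hEm] at hle
  linarith

theorem median_mem_Icc {m : ℕ} {v : Fin m → ℝ} (hv : ∀ k, v k ∈ Set.Icc (0 : ℝ) 1) :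
    median v ∈ Set.Icc (0 : ℝ) 1 := by
  unfold median
  split_ifs
  · exact hv _
  · simp

end Median

/-! ## The forecast of a forest -/

section Forecast

variable {d g n : ℕ} {A : Type} [NeZero g]

namespace DTree

theorem minLabel_le_eval (X : Fin d → A) (T : DTree d g A) : T.minLabel ≤ T.eval X := by
  induction T with
  | leaf y => exact le_rfl
  | node j test child ih => exact (Finset.inf'_le _ (Finset.mem_univ (test (X j)))).trans (ih _)

theorem eval_le_maxLabel (X : Fin d → A) (T : DTree d g A) : T.eval X ≤ T.maxLabel := by
  induction T with
  | leaf y => exact le_rfl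
  | node j test child ih =>
    exact (ih (test (X j))).trans
      (Finset.le_sup' (fun b => (child b).maxLabel) (Finset.mem_univ (test (X j))))

end DTree

variable [NeZero n]

theorem normalizedLabel_mem_Icc (F : Fin n → DTree d g A) (X : Fin d → A) (hF : yMin F < yMax F)
    (i : Fin n) : ((F i).eval X - yMin F) / (yMax F - yMin F) ∈ Set.Icc (0 : ℝ) 1 := by
  have h1 : yMin F ≤ (F i).eval X :=
    (Finset.inf'_le _ (Finset.mem_univ i)).trans ((F i).minLabel_le_eval X)
  have h2 : (F i).eval X ≤ yMax F :=
    ((F i).eval_le_maxLabel X).trans (Finset.le_sup' (fun i => (F i).maxLabel) (Finset.mem_univ i))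
  exact ⟨div_nonneg (by linarith) (by linarith), div_le_one_of_le₀ (by linarith) (by linarith)⟩

theorem sin_treeAngle_sq (F : Fin n → DTree d g A) (X : Fin d → A) (hF : yMin F < yMax F)
    (i : Fin n) :
    Real.sin (treeAngle F X i) ^ 2 = ((F i).eval X - yMin F) / (yMax F - yMin F) := by
  obtain ⟨h0, h1⟩ := normalizedLabel_mem_Icc F X hF i
  have hs := Real.sqrt_nonneg (((F i).eval X - yMin F) / (yMax F - yMin F))
  rw [treeAngle, leafAngle, Real.sin_arcsin (by linarith) (Real.sqrt_le_one.2 h1), Real.sq_sqrt h0]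

theorem normalizedForecast_mem_Icc (F : Fin n → DTree d g A) (X : Fin d → A)
    (hF : yMin F < yMax F) : normalizedForecast F X ∈ Set.Icc (0 : ℝ) 1 := by
  have hn : (0 : ℝ) < n := by exact_mod_cast NeZero.pos n
  have h := normalizedLabel_mem_Icc F X hF
  constructor
  · exact mul_nonneg (by positivity) (Finset.sum_nonneg fun i _ => (h i).1)
  · rw [normalizedForecast, one_div, inv_mul_le_iff₀ hn, mul_one]
    simpa using Finset.sum_le_card_nsmul Finset.univ _ 1 fun i _ => (h i).2

theorem forecast_eq (F : Fin n → DTree d g A) (X : Fin d → A) (hF : yMin F < yMax F) :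
    forecast F X = yMin F + (yMax F - yMin F) * normalizedForecast F X := by
  have hn : (n : ℝ) ≠ 0 := by exact_mod_cast NeZero.ne n
  have hD : yMax F - yMin F ≠ 0 := (sub_pos.2 hF).ne'
  rw [normalizedForecast, forecast, ← Finset.sum_div, Finset.sum_sub_distrib]
  simp only [Finset.sum_const, Finset.card_univ, Fintype.card_fin, nsmul_eq_mul]
  field_simp
  ring

/-- A vector of norm `|s|` is `s` times a unit vector. -/
theorem exists_unit_smul (v : Fin n → ℝ) {s : ℝ} (h : ∑ i, v i ^ 2 = s ^ 2) :
    ∃ u : Fin n → ℝ, ∑ i, u i ^ 2 = 1 ∧ ∀ i, v i = s * u i := by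
  -- When `s = 0` the vector is zero and any unit vector will do; this covers `β = 0` and `β = 1`.
  by_cases hs : s = 0
  · subst hs
    refine ⟨Pi.single 0 1, by simp [Pi.single_apply], fun i => ?_⟩
    have h' := (Finset.sum_eq_zero_iff_of_nonneg fun i _ => sq_nonneg (v i)).1
      (h.trans (zero_pow two_ne_zero)) i (Finset.mem_univ i)
    simpa using h'
  · refine ⟨fun i => v i / s, ?_, fun i => (mul_div_cancel₀ _ hs).symm⟩
    simp only [div_pow]
    rw [← Finset.sum_div, h, div_self (pow_ne_zero 2 hs)]

theorem exists_isGroverPlane (F : Fin n → DTree d g A) (X : Fin d → A) {θ : ℝ}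
    (hF : yMin F < yMax F) (hθ : Real.sin θ ^ 2 = normalizedForecast F X) :
    ∃ b c, IsGroverPlane F X b c θ := by
  have hn : (0 : ℝ) < n := by exact_mod_cast NeZero.pos n
  have hs : ∑ i, (Real.sin (treeAngle F X i) / Real.sqrt n) ^ 2 = Real.sin θ ^ 2 := by
    simp only [div_pow, Real.sq_sqrt hn.le, sin_treeAngle_sq F X hF]
    rw [hθ, ← Finset.sum_div, normalizedForecast, one_div, div_eq_inv_mul]
  have hc : ∑ i, (Real.cos (treeAngle F X i) / Real.sqrt n) ^ 2 = Real.cos θ ^ 2 := by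
    rw [Real.cos_sq', ← hs]
    simp only [div_pow, Real.sq_sqrt hn.le, Real.cos_sq']
    rw [← Finset.sum_div, ← Finset.sum_div, Finset.sum_sub_distrib]
    simp [sub_div, hn.ne']
  obtain ⟨b, hb, hb'⟩ := exists_unit_smul _ hc
  obtain ⟨c, hc, hc'⟩ := exists_unit_smul _ hs
  exact ⟨b, c, hb, hc, hb', hc'⟩

variable [NeZero d] [AddCommGroup A]

theorem run_forestCircuit_zeroLabel (F : Fin n → DTree d g A) {H : Matrix.unitaryGroup (Fin n) ℂ}
    (hH : ∀ i, (H : Matrix (Fin n) (Fin n) ℂ) i 0 = 1 / (Real.sqrt n : ℂ)) (X : Fin d → A)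
    (t : ℕ) [NeZero t] :
    (forestCircuit F H t).run X (ket (zeroLabel F t)) =
      ∑ i, (1 / (Real.sqrt n : ℂ)) •
        ((Real.cos (treeAngle F X i) : ℂ) • ket (leafLabel F X (0 : Fin t) (i, 0)) +
          (Real.sin (treeAngle F X i) : ℂ) • ket (leafLabel F X (0 : Fin t) (i, 1))) := by
  refine (run_forestCircuit F H X (0 : Fin t) 0).trans ?_
  rw [superpose, Fintype.sum_prod_type]
  refine Finset.sum_congr rfl fun i _ => ?_
  simp [Fin.sum_univ_two, forestMatrix, hH, rotMatrix, mul_smul]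

/-! ### Error bound, number of repetitions and cost -/

/-- The bound for the error of amplitude estimation with parameter `t` at the probability `β`. -/
noncomputable def estimationError (β : ℝ) (t : ℕ) : ℝ :=
  2 * Real.pi * Real.sqrt (β * (1 - β)) / t + Real.pi ^ 2 / (t : ℝ) ^ 2

theorem runsLaw_real_ge {F : Fin n → DTree d g A} {H : Matrix.unitaryGroup (Fin n) ℂ}
    (hH : ∀ i, (H : Matrix (Fin n) (Fin n) ℂ) i 0 = 1 / (Real.sqrt n : ℂ))
    (hF : yMin F < yMax F) (X : Fin d → A) (t : ℕ) [NeZero t] {r : ℕ} (hr : 0 < r) :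
    1 - (84 / 100 : ℝ) ^ r ≤ (runsLaw F H t (2 * r) X).real
      {ys | |betaEstimate ys - normalizedForecast F X| ≤
        estimationError (normalizedForecast F X) t} := by
  set β := normalizedForecast F X with hβ
  obtain ⟨h0, h1⟩ : β ∈ Set.Icc (0 : ℝ) 1 := normalizedForecast_mem_Icc F X hF
  set θ := Real.arcsin (Real.sqrt β) with hθ
  have hsin : Real.sin θ = Real.sqrt β :=
    Real.sin_arcsin (by linarith [Real.sqrt_nonneg β]) (Real.sqrt_le_one.2 h1)
  have hsin2 : Real.sin θ ^ 2 = β := by rw [hsin, Real.sq_sqrt h0]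
  have hcos : Real.cos θ = Real.sqrt (1 - β) := by rw [hθ, Real.cos_arcsin, Real.sq_sqrt h0]
  obtain ⟨b, c, hp⟩ := exists_isGroverPlane F X hF hsin2
  -- For `θ = arcsin √β` one has `sin 2θ = 2 √(β (1 - β))`.
  have hbound : |Real.sin (2 * θ)| * (Real.pi / t) + (Real.pi / t) ^ 2 = estimationError β t := by
    rw [Real.sin_two_mul, hsin, hcos, mul_assoc, ← Real.sqrt_mul h0,
      abs_of_nonneg (by positivity), estimationError, div_pow]
    ring
  have hset : ∀ x : ℝ, x ∈ Set.Icc (β - estimationError β t) (β + estimationError β t) ↔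
      |x - β| ≤ estimationError β t := fun x => by
    rw [Set.mem_Icc, abs_le]; constructor <;> rintro ⟨_, _⟩ <;> constructor <;> linarith
  have hgood := counterLaw_good_ge hH hp t
  rw [hbound, hsin2] at hgood
  simp only [← hset] at hgood ⊢
  exact pi_real_median_mem_ge (counterLaw F H t X).toMeasure
    (fun y => Real.sin (Real.pi * ((y : ℕ) : ℝ) / (t : ℝ)) ^ 2) hgood hr

/-- The number of repetitions is twice this number. -/
noncomputable def halfReps (δ : ℝ) : ℕ := ⌈8 * Real.log (1 / δ)⌉₊

theorem halfReps_pos {δ : ℝ} (h0 : 0 < δ) (h1 : δ < 1) : 0 < halfReps δ :=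
  Nat.ceil_pos.2 (mul_pos (by norm_num) (Real.log_pos (one_lt_one_div h0 h1)))

theorem pow_halfReps_le {δ : ℝ} (h0 : 0 < δ) : (84 / 100 : ℝ) ^ halfReps δ ≤ δ := by
  have h2 : 8 * Real.log (1 / δ) ≤ halfReps δ := Nat.le_ceil _
  rw [one_div, Real.log_inv] at h2
  -- From `1 + x ≤ e^x` the right side is at least `7/8`; this is what the factor `8` in `halfReps`
  -- is for.
  have h3 : (84 / 100 : ℝ) ≤ Real.exp (-1 / 8) := by
    have := Real.add_one_le_exp (-1 / 8 : ℝ)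
    linarith
  calc (84 / 100 : ℝ) ^ halfReps δ ≤ Real.exp (-1 / 8) ^ halfReps δ := by gcongr
    _ = Real.exp (halfReps δ * (-1 / 8)) := (Real.exp_nat_mul _ _).symm
    _ ≤ Real.exp (Real.log δ) := Real.exp_le_exp.2 (by linarith)
    _ = δ := Real.exp_log h0

theorem halfReps_le {δ : ℝ} (h0 : 0 < δ) (h1 : δ < 1) :
    (halfReps δ : ℝ) ≤ 9 * max 1 (Real.log (1 / δ)) := by
  have hlog := Real.log_pos (one_lt_one_div h0 h1)
  have h := Nat.ceil_lt_add_one (a := 8 * Real.log (1 / δ)) (by positivity)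
  have h2 := le_max_left 1 (Real.log (1 / δ))
  have h3 := le_max_right 1 (Real.log (1 / δ))
  unfold halfReps
  linarith

theorem runsQueries_le (F : Fin n → DTree d g A) (H : Matrix.unitaryGroup (Fin n) ℂ) (t : ℕ)
    [NeZero t] {δ : ℝ} (h0 : 0 < δ) (h1 : δ < 1) :
    (runsQueries F H t (2 * halfReps δ) : ℝ) ≤
      72 * t * forestHeight F * max 1 (Real.log (1 / δ)) := by
  have h : ((estimationCircuit F H t).queries : ℝ) ≤ 4 * t * forestHeight F := by
    exact_mod_cast queries_estimationCircuit_le F H t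
  have h2 := halfReps_le h0 h1
  calc (runsQueries F H t (2 * halfReps δ) : ℝ)
      = 2 * halfReps δ * (estimationCircuit F H t).queries := by rw [runsQueries]; push_cast; ring
    _ ≤ 2 * (9 * max 1 (Real.log (1 / δ))) * (4 * t * forestHeight F) := by gcongr
    _ = _ := by ring

theorem betaEstimate_mem_Icc {m t : ℕ} (ys : Fin m → Fin t) :
    betaEstimate ys ∈ Set.Icc (0 : ℝ) 1 :=
  median_mem_Icc fun _ => ⟨sq_nonneg _, Real.sin_sq_le_one _⟩

/-- The error for `β` is multiplied by `D = y_max - y_min`, and `T ≥ t D` yields the first bound.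
The second follows from it if `t D ≥ 1`. -/
theorem abs_forecastEstimate_sub_le (F : Fin n → DTree d g A) (X : Fin d → A)
    (hF : yMin F < yMax F) {t T m : ℕ} [NeZero T] (ht : 0 < t)
    (hT : T = ⌈t * (yMax F - yMin F)⌉₊) (ys : Fin m → Fin T)
    (h : |betaEstimate ys - normalizedForecast F X| ≤
      estimationError (normalizedForecast F X) T) :
    |forecastEstimate F ys - forecast F X| ≤
        2 * Real.pi * Real.sqrt (normalizedForecast F X * (1 - normalizedForecast F X)) / t
          + Real.pi ^ 2 / ((t : ℝ) ^ 2 * (yMax F - yMin F)) ∧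
      |forecastEstimate F ys - forecast F X| ≤ (2 * Real.pi + Real.pi ^ 2) / t := by
  obtain ⟨hβ0, hβ1⟩ := normalizedForecast_mem_Icc F X hF
  obtain ⟨he0, he1⟩ := betaEstimate_mem_Icc ys
  have hD : 0 < yMax F - yMin F := sub_pos.2 hF
  have ht' : (0 : ℝ) < t := by exact_mod_cast ht
  have hTD : t * (yMax F - yMin F) ≤ T := by rw [hT]; exact Nat.le_ceil _
  have hpi := Real.pi_pos
  have habs : |forecastEstimate F ys - forecast F X| =
      (yMax F - yMin F) * |betaEstimate ys - normalizedForecast F X| := by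
    rw [forecast_eq F X hF, forecastEstimate, add_sub_add_left_eq_sub, ← mul_sub, abs_mul,
      abs_of_pos hD]
  set β := normalizedForecast F X
  set D := yMax F - yMin F
  set q := Real.sqrt (β * (1 - β)) with hq
  have hq0 : 0 ≤ q := Real.sqrt_nonneg _
  have hq1 : q ≤ 1 := Real.sqrt_le_one.2 (by nlinarith)
  have h1 : |forecastEstimate F ys - forecast F X| ≤
      2 * Real.pi * q / t + Real.pi ^ 2 / ((t : ℝ) ^ 2 * D) :=
    calc |forecastEstimate F ys - forecast F X| ≤ D * estimationError β T := by
          rw [habs]; gcongr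
      _ ≤ D * (2 * Real.pi * q / (t * D) + Real.pi ^ 2 / (t * D) ^ 2) := by
          unfold estimationError; gcongr
      _ = _ := by field_simp
  refine ⟨h1, ?_⟩
  rcases le_or_gt 1 (t * D) with hc | hc
  · refine h1.trans ?_
    rw [add_div]
    refine add_le_add ?_ ?_
    · have := mul_le_of_le_one_right (a := 2 * Real.pi) (by positivity) hq1
      gcongr
    · gcongr; rw [sq, mul_assoc]; exact le_mul_of_one_le_right ht'.le hc
  -- If `t D < 1`, the trivial error `D < 1/t` is already small enough, as both numbers lie in `[0,
  -- 1]`.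
  · have h2 : |betaEstimate ys - β| ≤ 1 := by rw [abs_le]; constructor <;> linarith
    rw [habs, le_div_iff₀ ht']
    have h3 : D * |betaEstimate ys - β| ≤ D := mul_le_of_le_one_right hD.le h2
    nlinarith [Real.pi_gt_three, mul_le_mul_of_nonneg_right h3 ht'.le]

end Forecast

theorem mainTheorem1 :
    ∃ (reps : ℝ → ℕ) (C : ℝ),
      ∀ (d g n : ℕ) [NeZero d] [NeZero g] [NeZero n] (A : Type) [AddCommGroup A]
        (F : Fin n → DTree d g A) (H : Matrix.unitaryGroup (Fin n) ℂ),
        (∀ i, (H : Matrix (Fin n) (Fin n) ℂ) i 0 = 1 / (Real.sqrt n : ℂ)) →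
        yMin F < yMax F →
        ∀ X : Fin d → A,
          -- the state prepared by the circuit
          (∀ (t : ℕ) [NeZero t], ∃ p : Fin n → Fin (forestHeight F) → Fin g,
            (∀ i, nodeAt (F i) (p i) (forestHeight F) = DTree.leaf ((F i).eval X)) ∧
            (forestCircuit F H t).run X (ket (zeroLabel F t)) =
              ∑ i, (1 / (Real.sqrt n : ℂ)) •
                ((Real.cos (leafAngle F ((F i).eval X)) : ℂ) •
                    ket ((0, 0, ⟨0, i, p i, 0⟩) : ForestBasis F t) +
                  (Real.sin (leafAngle F ((F i).eval X)) : ℂ) •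
                    ket ((0, 0, ⟨0, i, p i, 1⟩) : ForestBasis F t))) ∧
          -- forecasting the normalized value
          (∀ (t : ℕ) [NeZero t] (δ : ℝ), 0 < δ → δ < 1 →
            1 - δ ≤ (runsLaw F H t (reps δ) X).real
              {ys | |betaEstimate ys - normalizedForecast F X| ≤
                2 * Real.pi * Real.sqrt (normalizedForecast F X * (1 - normalizedForecast F X)) / t
                  + Real.pi ^ 2 / (t : ℝ) ^ 2} ∧
            (runsQueries F H t (reps δ) : ℝ) ≤
              C * t * forestHeight F * max 1 (Real.log (1 / δ))) ∧
          -- forecasting the average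
          (∀ (t : ℕ) (T : ℕ) [NeZero T] (δ : ℝ), 0 < t → T = ⌈t * (yMax F - yMin F)⌉₊ →
            0 < δ → δ < 1 →
            1 - δ ≤ (runsLaw F H T (reps δ) X).real
              {ys | |forecastEstimate F ys - forecast F X| ≤
                  2 * Real.pi * Real.sqrt (normalizedForecast F X * (1 - normalizedForecast F X)) / t
                    + Real.pi ^ 2 / ((t : ℝ) ^ 2 * (yMax F - yMin F)) ∧
                |forecastEstimate F ys - forecast F X| ≤ (2 * Real.pi + Real.pi ^ 2) / t} ∧
            (runsQueries F H T (reps δ) : ℝ) ≤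
              C * max 1 (t * (yMax F - yMin F)) * forestHeight F *
                max 1 (Real.log (1 / δ))) := by
  refine ⟨fun δ => 2 * halfReps δ, 144, fun d g n _ _ _ A _ F H hH hF X => ⟨fun t _ =>
    ⟨leafPath F X, nodeAt_leafPath F X, run_forestCircuit_zeroLabel F hH X t⟩,
    fun t _ δ h0 h1 => ⟨?_, (runsQueries_le F H t h0 h1).trans ?_⟩,
    fun t T _ δ ht hT h0 h1 => ⟨?_, (runsQueries_le F H T h0 h1).trans ?_⟩⟩⟩
  · have h := runsLaw_real_ge hH hF X t (halfReps_pos h0 h1)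
    have h2 := pow_halfReps_le h0
    exact le_trans (by linarith) h
  · gcongr
    norm_num
  · have h := runsLaw_real_ge hH hF X T (halfReps_pos h0 h1)
    have h2 := pow_halfReps_le h0
    have : IsProbabilityMeasure (runsLaw F H T (2 * halfReps δ) X) := by
      unfold runsLaw; infer_instance
    exact le_trans (by linarith)
      (h.trans (measureReal_mono fun ys hys => abs_forecastEstimate_sub_le F X hF ht hT ys hys))
  · have hD : 0 < yMax F - yMin F := sub_pos.2 hF
    -- Rounding up gives `T ≤ 2 max (1, t D)`, which doubles the constant `72` to `144`.
    have h : (T : ℝ) ≤ t * (yMax F - yMin F) + 1 := by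
      rw [hT]; exact (Nat.ceil_lt_add_one (by positivity)).le
    have h2 := le_max_left 1 (t * (yMax F - yMin F))
    have h3 := le_max_right 1 (t * (yMax F - yMin F))
    have h4 : 72 * (T : ℝ) ≤ 144 * max 1 (t * (yMax F - yMin F)) := by linarith
    gcongr
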